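/- Let $Z=(Z_t)_{t\ge 0}$ be a real-valued Lévy process without Gaussian component, so that $E e^{i\xi Z_t}=e^{-t\psi(\xi)}$ with $$\psi(\xi)=ia\xi+\int_{\mathbb R}\big(1-e^{i\xi u}+i\xi u\,\mathbf 1_{|u|<1}\big)\,\mu(du),\qquad \xi\in\mathbb R,$$ where $a\in\mathbb R$ and $\mu$ is a Lévy measure, i.e. $\mu(\{0\})=0$ and $\int_{\mathbb R}(1\wedge u^2)\,\mu(du)<\infty$. Assume that $\mu(\mathbb R)=\infty$, that $Z$ is symmetric ($-Z_t$ has the same law as $Z_t$ for every $t\ge 0$; equivalently, $\psi$ is real-valued), and that condition A holds: there is $\beta>1$ such that $$\int_{\mathbb R}\big((\xi u)^2\wedge 1\big)\,\mu(du)\le\beta\int_{|\xi u|<1}(\xi u)^2\,\mu(du)\qquad\text{for all }\xi\in\mathbb R.$$ For $t>0$ put $\rho_t=\inf\{\xi>0:\operatorname{Re}\psi(\xi)\ge 1/t\}$ and $\Lambda_t(du)=t\,\mathbf 1_{|\rho_t u|>1}\,\mu(du)$, and let $\Lambda_t^{*m}$ be the $m$-fold convolution power of $\Lambda_t$, with $\Lambda_t^{*0}=\delta_0$.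 Then for every $t>0$ the measure $\Lambda_t$ is finite, $Z_t$ has an infinitely differentiable density $p_t$, and the following hold (all integrals and series below being convergent). 1. For every $t_0>0$ there exist constants $b_1,b_2,b_3,b_4>0$ such that, with $$f_{upper}(x)=b_1e^{-b_2|x|\ln(1+|x|)},\qquad f_{lower}(x)=b_3\mathbf 1_{|x|\le b_4},$$ for all $t\in(0,t_0]$ and $x\in\mathbb R$, $$\sum_{m=0}^\infty\frac1{m!}\int_{\mathbb R}\rho_t\,f_{lower}\big((x-y)\rho_t\big)\,\Lambda_t^{*m}(dy)\;\le\; p_t(x)\;\le\;\sum_{m=0}^\infty\frac1{m!}\int_{\mathbb R}\rho_t\,f_{upper}\big((x-y)\rho_t\big)\,\Lambda_t^{*m}(dy).$$ 2. For every integer $k\ge 1$ and every $t_0>0$ there exist constants $b_1,b_2>0$ such that, with $f_{upper}(x)=b_1e^{-b_2|x|\ln(1+|x|)}$, for all $t\in(0,t_0]$ and $x\in\mathbb R$, $$\left|\frac{\partial^k}{\partial x^k}p_t(x)\right|\le\sum_{m=0}^\infty\frac1{m!}\int_{\mathbb R}\rho_t^{k+1}\,f_{upper}\big((x-y)\rho_t\big)\,\Lambda_t^{*m}(dy).$$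 -/

import Mathlib

open MeasureTheory ProbabilityTheory Filter Topology
open scoped NNReal ENNReal

noncomputable section

namespace LevyKernel

/-- A real-valued Lévy process on the probability space `(Ω, P)`: it starts at `0`, has independent
and stationary increments, and is stochastically continuous. -/
structure IsLevyProcess {Ω : Type*} [MeasurableSpace Ω] (Z : ℝ≥0 → Ω → ℝ) (P : Measure Ω) :
    Prop where
  measurable : ∀ t, Measurable (Z t)
  zero : ∀ᵐ ω ∂P, Z 0 ω = 0
  indep : HasIndepIncrements Z P
  stationary : ∀ s t : ℝ≥0, P.map (fun ω => Z (s + t) ω - Z s ω) = P.map (Z t)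
  stochCont : ∀ s : ℝ≥0, TendstoInMeasure P Z (𝓝 s) (Z s)

/-- The process is symmetric: `Z t` and `-Z t` have the same law for every `t`. -/
def IsSymmetricProcess {Ω : Type*} [MeasurableSpace Ω] (Z : ℝ≥0 → Ω → ℝ) (P : Measure Ω) : Prop :=
  ∀ t : ℝ≥0, P.map (fun ω => -Z t ω) = P.map (Z t)

/-- A Lévy measure on `ℝ`: no mass at `0` and `∫ (1 ∧ u²) μ(du) < ∞`. -/
def IsLevyMeasure (μ : Measure ℝ) : Prop :=
  μ {0} = 0 ∧ ∫⁻ u, ENNReal.ofReal (min 1 (u ^ 2)) ∂μ < ∞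

/-- The exponent `ψ(ξ) = i a ξ + ∫ (1 - e^{iξu} + iξu 1_{|u| < 1}) μ(du)`
(no Gaussian component). -/
def charExponent (a : ℝ) (μ : Measure ℝ) (ξ : ℝ) : ℂ :=
  Complex.I * a * ξ +
    ∫ u : ℝ, (1 - Complex.exp (Complex.I * ξ * u) +
      (if |u| < 1 then Complex.I * ξ * u else 0)) ∂μ

/-- `Z` has characteristic exponent `ψ`: `E exp(iξ Z_t) = exp(-t ψ(ξ))`. -/
def HasCharExponent {Ω : Type*} [MeasurableSpace Ω] (Z : ℝ≥0 → Ω → ℝ) (P : Measure Ω)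
    (ψ : ℝ → ℂ) : Prop :=
  ∀ (t : ℝ≥0) (ξ : ℝ), charFun (P.map (Z t)) ξ = Complex.exp (-((t : ℝ) : ℂ) * ψ ξ)

/-- `ψ^L(ξ) = ∫_{|ξu| < 1} (ξu)² μ(du)`. -/
def psiL (μ : Measure ℝ) (ξ : ℝ) : ℝ :=
  ∫ u : ℝ, (if |ξ * u| < 1 then (ξ * u) ^ 2 else 0) ∂μ

/-- `ψ^U(ξ) = ∫ ((ξu)² ∧ 1) μ(du)`. -/
def psiU (μ : Measure ℝ) (ξ : ℝ) : ℝ :=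
  ∫ u : ℝ, min ((ξ * u) ^ 2) 1 ∂μ

/-- Condition **A**: `ψ^U ≤ β ψ^L` on `ℝ` for some `β > 1`. -/
def ConditionA (μ : Measure ℝ) : Prop :=
  ∃ β : ℝ, 1 < β ∧ ∀ ξ : ℝ, psiU μ ξ ≤ β * psiL μ ξ

/-- `ρ_t = inf {ξ > 0 : Re ψ(ξ) ≥ 1/t}`, for `t > 0`. -/
def rho (ψ : ℝ → ℂ) (t : ℝ) : ℝ :=
  sInf {ξ : ℝ | 0 < ξ ∧ 1 / t ≤ (ψ ξ).re}

/-- `Λ_t(du) = t 1_{|ρ_t u| > 1} μ(du)`. -/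
def Lam (ψ : ℝ → ℂ) (μ : Measure ℝ) (t : ℝ) : Measure ℝ :=
  ENNReal.ofReal t • μ.restrict {u : ℝ | 1 < |rho ψ t * u|}

/-- The `m`-fold convolution power `Q^{*m}`, with `Q^{*0} = δ_0`. -/
def convPow (Q : Measure ℝ) : ℕ → Measure ℝ
  | 0 => Measure.dirac 0
  | m + 1 => Measure.conv Q (convPow Q m)

/-- The term `(1/m!) ∫ σ_t h((x - y) ζ_t) Q_t^{*m}(dy)` of the compound kernel. -/
def compoundTerm (σ : ℝ → ℝ) (h : ℝ → ℝ) (ζ : ℝ → ℝ) (Q : ℝ → Measure ℝ) (t x : ℝ) (m : ℕ) : ℝ :=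
  (1 / (m.factorial : ℝ)) * ∫ y : ℝ, σ t * h ((x - y) * ζ t) ∂(convPow (Q t) m)

/-- The compound kernel with parameters `(σ, h, ζ, Q)` is meaningful at `(t, x)`: the measure `Q_t`
is finite, all the integrals converge, and so does the series. -/
structure CompoundKernelConverges (σ : ℝ → ℝ) (h : ℝ → ℝ) (ζ : ℝ → ℝ) (Q : ℝ → Measure ℝ)
    (t x : ℝ) : Prop where
  finite : IsFiniteMeasure (Q t)
  integrable : ∀ m : ℕ, Integrable (fun y : ℝ => σ t * h ((x - y) * ζ t)) (convPow (Q t) m)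
  summable : Summable (compoundTerm σ h ζ Q t x)

/-- `g` satisfies on `A` the upper compound kernel estimate with parameters `(σ, h, ζ, Q)`. -/
def UpperCompoundKernelEstimate (g : ℝ → ℝ → ℝ) (A : Set (ℝ × ℝ)) (σ : ℝ → ℝ) (h : ℝ → ℝ)
    (ζ : ℝ → ℝ) (Q : ℝ → Measure ℝ) : Prop :=
  ∀ t x : ℝ, (t, x) ∈ A →
    CompoundKernelConverges σ h ζ Q t x ∧ g t x ≤ ∑' m : ℕ, compoundTerm σ h ζ Q t x m

/-- `g` satisfies on `A` the lower compound kernel estimate with parameters `(σ, h, ζ, Q)`. -/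
def LowerCompoundKernelEstimate (g : ℝ → ℝ → ℝ) (A : Set (ℝ × ℝ)) (σ : ℝ → ℝ) (h : ℝ → ℝ)
    (ζ : ℝ → ℝ) (Q : ℝ → Measure ℝ) : Prop :=
  ∀ t x : ℝ, (t, x) ∈ A →
    CompoundKernelConverges σ h ζ Q t x ∧ ∑' m : ℕ, compoundTerm σ h ζ Q t x m ≤ g t x

/-- `f_upper(x) = b₁ exp(-b₂ |x| ln(1 + |x|))`. -/
def fUpperSym (b₁ b₂ : ℝ) (x : ℝ) : ℝ :=
  b₁ * Real.exp (-b₂ * |x| * Real.log (1 + |x|))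

/-- `f_lower(x) = b₃ 1_{|x| ≤ b₄}`. -/
def fLower (b₃ b₄ : ℝ) (x : ℝ) : ℝ :=
  b₃ * (if |x| ≤ b₄ then 1 else 0)

/-- `p t` is, for every `t > 0`, the nonnegative infinitely differentiable density of `Z t`.
(A continuous density is unique, so this determines `p t` everywhere.) -/
def IsSmoothTransitionDensity {Ω : Type*} [MeasurableSpace Ω] (Z : ℝ≥0 → Ω → ℝ) (P : Measure Ω)
    (p : ℝ → ℝ → ℝ) : Prop :=
  ∀ t : ℝ≥0, 0 < t →
    ContDiff ℝ (⊤ : ℕ∞) (p t) ∧ (∀ x : ℝ, 0 ≤ p t x) ∧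
      P.map (Z t) = volume.withDensity (fun x : ℝ => ENNReal.ofReal (p t x))

end LevyKernel

end

/-!
At time `t`, split the jumps of `Z` at the size `1 / ρ_t`. The large jumps have finite intensity
`Λ_t` and contribute the compound Poisson law `e^{-Λ_t(ℝ)} ∑ Λ_t^{*m} / m!`; the small jumps,
rescaled by `ρ_t`, have a Lévy measure `ν` on `[-1, 1]`. Condition **A** makes `ψ^U` grow like a
power, with an exponent depending only on `β`, and `t ψ(ρ_t) = 1`, so `Λ_t(ℝ)`, `∫ v² dν` and the
decay of `e^{-cosExp ν}` are controlled uniformly in `t`. It remains to prove bounds with constants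
depending on these quantities only for the density with Fourier transform `e^{-cosExp ν}`. Since `ν`
has bounded support, the exponent is entire, and shifting the Fourier contour into the complex plane
by `log(1 + |x|) / 4` gives the decay `e^{-c |x| log(1 + |x|)}`; at `0` the density is bounded below
by a Gaussian integral, and its derivative is bounded, whence the lower bound near `0`.

The density is nonnegative because compound Poisson laws approximate it. Symmetry of `μ` is
recovered from `Im ψ = 0`: second differences of `Im ψ` are sine transforms of finite weighted
versions of `μ`, which therefore have real characteristic functions.
-/

namespace LevyKernel

open Complex (I)
open scoped Real FourierTransform

/-! ### Exponential of a finite measure with respect to convolution -/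

instance isFiniteMeasure_convPow (Q : Measure ℝ) [IsFiniteMeasure Q] (m : ℕ) :
    IsFiniteMeasure (convPow Q m) := by
  induction m with
  | zero => rw [convPow]; infer_instance
  | succ m ih => rw [convPow]; infer_instance

theorem charFun_convPow (Q : Measure ℝ) [IsFiniteMeasure Q] (m : ℕ) (ξ : ℝ) :
    charFun (convPow Q m) ξ = charFun Q ξ ^ m := by
  induction m with
  | zero => simp [convPow]
  | succ m ih => rw [convPow, charFun_conv, ih, pow_succ']

theorem convPow_real_univ (Q : Measure ℝ) [IsFiniteMeasure Q] (m : ℕ) :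
    (convPow Q m).real Set.univ = Q.real Set.univ ^ m := by
  have h := charFun_convPow Q m 0
  rw [charFun_zero, charFun_zero] at h
  exact_mod_cast h

/-- The exponential `∑ Q^{*m} / m!` of `Q` with respect to convolution. Up to the factor
`exp (-Q ℝ)` it is the compound Poisson law with jump measure `Q`. -/
noncomputable def convExp (Q : Measure ℝ) : Measure ℝ :=
  Measure.sum fun m : ℕ => ENNReal.ofReal (1 / (m.factorial : ℝ)) • convPow Q m

theorem convExp_univ (Q : Measure ℝ) [IsFiniteMeasure Q] :
    convExp Q Set.univ = ENNReal.ofReal (Real.exp (Q.real Set.univ)) := by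
  have hs : HasSum (fun m : ℕ => Q.real Set.univ ^ m / (m.factorial : ℝ))
      (Real.exp (Q.real Set.univ)) := by
    rw [Real.exp_eq_exp_ℝ]
    exact NormedSpace.expSeries_div_hasSum_exp _
  rw [convExp, Measure.sum_apply _ MeasurableSet.univ, ← hs.tsum_eq,
    ENNReal.ofReal_tsum_of_nonneg (fun m => by positivity) hs.summable]
  refine tsum_congr fun m => ?_
  rw [Measure.smul_apply, smul_eq_mul, ← ofReal_measureReal (μ := convPow Q m), convPow_real_univ,
    ← ENNReal.ofReal_mul (by positivity), one_div_mul_eq_div]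

instance isFiniteMeasure_convExp (Q : Measure ℝ) [IsFiniteMeasure Q] :
    IsFiniteMeasure (convExp Q) :=
  ⟨by rw [convExp_univ]; exact ENNReal.ofReal_lt_top⟩

theorem hasSum_integral_convExp {E : Type*} [NormedAddCommGroup E] [NormedSpace ℝ E]
    {Q : Measure ℝ} {f : ℝ → E} (hf : Integrable f (convExp Q)) :
    HasSum (fun m : ℕ => (1 / (m.factorial : ℝ)) • ∫ y, f y ∂(convPow Q m))
      (∫ y, f y ∂(convExp Q)) := by
  refine (hasSum_integral_measure hf).congr_fun fun m => ?_
  rw [integral_smul_measure, ENNReal.toReal_ofReal (by positivity)]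

theorem norm_cexp_ofReal_mul_ofReal_mul_I (ξ x : ℝ) : ‖Complex.exp (ξ * x * I)‖ = 1 := by
  rw [← Complex.ofReal_mul, Complex.norm_exp_ofReal_mul_I]

theorem integrable_cexp_mul_I (Q : Measure ℝ) [IsFiniteMeasure Q] (ξ : ℝ) :
    Integrable (fun x : ℝ => Complex.exp (ξ * x * I)) Q :=
  .of_bound (by fun_prop) 1 (ae_of_all _ fun x => (norm_cexp_ofReal_mul_ofReal_mul_I ξ x).le)

theorem charFun_convExp (Q : Measure ℝ) [IsFiniteMeasure Q] (ξ : ℝ) :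
    charFun (convExp Q) ξ = Complex.exp (charFun Q ξ) := by
  have hexp : HasSum (fun m : ℕ => charFun Q ξ ^ m / (m.factorial : ℂ))
      (Complex.exp (charFun Q ξ)) := by
    rw [Complex.exp_eq_exp_ℂ]
    exact NormedSpace.expSeries_div_hasSum_exp _
  rw [charFun_apply_real]
  refine (hasSum_integral_convExp (integrable_cexp_mul_I _ ξ)).unique (hexp.congr_fun fun m => ?_)
  rw [← charFun_apply_real, charFun_convPow, Complex.real_smul]
  push_cast
  ring

/-! ### Shifting the contour of integration -/

section ContourShift

variable {E : Type*} [NormedAddCommGroup E] [NormedSpace ℂ E] {h : ℂ → E} {g : ℝ → ℝ} {R : ℝ}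

theorem norm_intervalIntegral_sub_shift_le (hd : Differentiable ℂ h)
    (hb : ∀ x : ℝ, ∀ y ∈ Set.uIcc 0 R, ‖h (x + y * I)‖ ≤ g x) (T : ℝ) :
    ‖(∫ x in (-T)..T, h x) - ∫ x in (-T)..T, h (x + R * I)‖ ≤ (g T + g (-T)) * |R| := by
  have hside : ∀ S : ℝ, ‖∫ y in (0 : ℝ)..R, h (S + y * I)‖ ≤ g S * |R| := fun S => by
    simpa using intervalIntegral.norm_integral_le_of_norm_le_const fun y hy =>
      hb S y (Set.uIoc_subset_uIcc hy)
  have hrect := Complex.integral_boundary_rect_eq_zero_of_differentiableOn h (⟨-T, 0⟩ : ℂ) ⟨T, R⟩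
    hd.differentiableOn
  simp only [Complex.ofReal_zero, zero_mul, add_zero] at hrect
  have hsides : (∫ x in (-T)..T, h x) - ∫ x in (-T)..T, h (x + R * I) =
      I • (∫ y in (0 : ℝ)..R, h ((-T : ℝ) + y * I)) - I • ∫ y in (0 : ℝ)..R, h (T + y * I) := by
    linear_combination (norm := module) hrect
  calc ‖(∫ x in (-T)..T, h x) - ∫ x in (-T)..T, h (x + R * I)‖
      ≤ ‖∫ y in (0 : ℝ)..R, h ((-T : ℝ) + y * I)‖ + ‖∫ y in (0 : ℝ)..R, h (T + y * I)‖ := by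
        rw [hsides]
        refine (norm_sub_le _ _).trans_eq ?_
        rw [norm_smul, norm_smul, Complex.norm_I, one_mul, one_mul]
    _ ≤ (g T + g (-T)) * |R| := by linarith [hside T, hside (-T)]

theorem integral_eq_integral_add_mul_I (hd : Differentiable ℂ h) (hg : Integrable g)
    (hg0 : Tendsto g (cocompact ℝ) (𝓝 0))
    (hb : ∀ x : ℝ, ∀ y ∈ Set.uIcc 0 R, ‖h (x + y * I)‖ ≤ g x) :
    ∫ x : ℝ, h x = ∫ x : ℝ, h (x + R * I) := by
  have hi : ∀ y ∈ Set.uIcc 0 R, Integrable fun x : ℝ => h (x + y * I) := fun y hy =>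
    hg.mono' (hd.continuous.comp (by fun_prop)).aestronglyMeasurable (ae_of_all _ (hb · y hy))
  have h0 : Integrable fun x : ℝ => h x := by simpa using hi 0 Set.left_mem_uIcc
  have hlim := (intervalIntegral_tendsto_integral h0 tendsto_neg_atTop_atBot tendsto_id).sub
    (intervalIntegral_tendsto_integral (hi R Set.right_mem_uIcc) tendsto_neg_atTop_atBot tendsto_id)
  rw [cocompact_eq_atBot_atTop, tendsto_sup] at hg0
  have hzero : Tendsto (fun T => (g T + g (-T)) * |R|) atTop (𝓝 0) := by
    simpa using (hg0.2.add (hg0.1.comp tendsto_neg_atTop_atBot)).mul_const |R|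
  exact sub_eq_zero.1 <| tendsto_nhds_unique hlim <|
    squeeze_zero_norm (norm_intervalIntegral_sub_shift_le hd hb) hzero

end ContourShift

/-! ### Cosine exponents and their entire extensions -/

theorem norm_one_sub_cos_le (z : ℂ) : ‖1 - Complex.cos z‖ ≤ ‖z‖ ^ 2 * Real.exp ‖z‖ := by
  have htaylor : ∀ w : ℂ, ‖Complex.exp w - (1 + w)‖ ≤ ‖w‖ ^ 2 * Real.exp ‖w‖ := fun w => by
    simpa [Finset.sum_range_succ] using Complex.norm_exp_sub_sum_le_norm_mul_exp w 2
  have hpos := htaylor (z * I)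
  have hneg := htaylor (-z * I)
  simp only [norm_mul, norm_neg, Complex.norm_I, mul_one] at hpos hneg
  have heq : 1 - Complex.cos z = -((Complex.exp (z * I) - (1 + z * I)) +
      (Complex.exp (-z * I) - (1 + -z * I))) / 2 := by
    rw [Complex.cos]; ring
  rw [heq, norm_div, norm_neg, Complex.norm_ofNat]
  linarith [norm_add_le (Complex.exp (z * I) - (1 + z * I)) (Complex.exp (-z * I) - (1 + -z * I))]

theorem norm_sin_le (z : ℂ) : ‖Complex.sin z‖ ≤ ‖z‖ * Real.exp ‖z‖ := by
  have htaylor : ∀ w : ℂ, ‖Complex.exp w - 1‖ ≤ ‖w‖ * Real.exp ‖w‖ := fun w => by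
    simpa [Finset.sum_range_succ] using Complex.norm_exp_sub_sum_le_norm_mul_exp w 1
  have hpos := htaylor (z * I)
  have hneg := htaylor (-z * I)
  simp only [norm_mul, norm_neg, Complex.norm_I, mul_one] at hpos hneg
  have heq : Complex.sin z =
      ((Complex.exp (-z * I) - 1) - (Complex.exp (z * I) - 1)) * I / 2 := by
    rw [Complex.sin]; ring
  rw [heq, norm_div, norm_mul, Complex.norm_I, mul_one, Complex.norm_ofNat]
  linarith [norm_sub_le (Complex.exp (-z * I) - 1) (Complex.exp (z * I) - 1)]

theorem cosh_sub_one_le (y : ℝ) : Real.cosh y - 1 ≤ y ^ 2 * Real.exp |y| := by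
  have h := norm_one_sub_cos_le (y * I)
  rw [Complex.cos_mul_I, ← Complex.ofReal_cosh, norm_mul, Complex.norm_I, mul_one,
    Complex.norm_real, Real.norm_eq_abs, sq_abs, ← Complex.ofReal_one, ← Complex.ofReal_sub,
    Complex.norm_real, Real.norm_eq_abs, abs_sub_comm] at h
  exact (le_abs_self _).trans h

theorem one_sub_cos_nonneg (x : ℝ) : 0 ≤ 1 - Real.cos x := sub_nonneg.2 (Real.cos_le_one x)

theorem one_sub_cos_mul_le (η v : ℝ) : 1 - Real.cos (η * v) ≤ η ^ 2 / 2 * v ^ 2 := by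
  have h := Real.one_sub_sq_div_two_le_cos (x := η * v)
  rw [mul_pow] at h
  linarith

/-- The real exponent `∫ (1 - cos (ηv)) ν(dv)`: the real part of `charExponent a ν`, and all of it
when `ν` is symmetric. -/
noncomputable def cosExp (ν : Measure ℝ) (η : ℝ) : ℝ := ∫ v : ℝ, (1 - Real.cos (η * v)) ∂ν

/-- The extension of `cosExp` to complex arguments, entire when `ν` has bounded support. -/
noncomputable def cosExpC (ν : Measure ℝ) (z : ℂ) : ℂ := ∫ v : ℝ, (1 - Complex.cos (z * v)) ∂ν

section CosExp

variable {ν : Measure ℝ}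

theorem cosExpC_ofReal (ν : Measure ℝ) (η : ℝ) : cosExpC ν η = cosExp ν η := by
  rw [cosExpC, cosExp, ← integral_complex_ofReal]
  congr 1 with v
  push_cast
  rfl

theorem cosExp_nonneg (ν : Measure ℝ) (η : ℝ) : 0 ≤ cosExp ν η :=
  integral_nonneg fun _ => one_sub_cos_nonneg _

theorem integrable_one_sub_cos (hν : Integrable (fun v : ℝ => v ^ 2) ν) (η : ℝ) :
    Integrable (fun v : ℝ => 1 - Real.cos (η * v)) ν := by
  refine (hν.const_mul (η ^ 2 / 2)).mono' (by fun_prop) (ae_of_all _ fun v => ?_)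
  rw [Real.norm_of_nonneg (one_sub_cos_nonneg _)]
  exact one_sub_cos_mul_le η v

theorem cosExp_le (hν : Integrable (fun v : ℝ => v ^ 2) ν) (η : ℝ) :
    cosExp ν η ≤ η ^ 2 / 2 * ∫ v : ℝ, v ^ 2 ∂ν := by
  rw [← integral_const_mul]
  exact integral_mono (integrable_one_sub_cos hν η) (hν.const_mul _) (one_sub_cos_mul_le η)

theorem integrable_one_sub_ccos (hs : ∀ᵐ v ∂ν, |v| ≤ 1)
    (hν : Integrable (fun v : ℝ => v ^ 2) ν) (z : ℂ) :
    Integrable (fun v : ℝ => 1 - Complex.cos (z * v)) ν := by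
  refine (hν.const_mul (‖z‖ ^ 2 * Real.exp ‖z‖)).mono' (by fun_prop) ?_
  filter_upwards [hs] with v hv
  have hzv : ‖z‖ * |v| ≤ ‖z‖ := mul_le_of_le_one_right (norm_nonneg _) hv
  calc ‖1 - Complex.cos (z * v)‖ ≤ (‖z‖ * |v|) ^ 2 * Real.exp (‖z‖ * |v|) := by
        simpa only [norm_mul, Complex.norm_real, Real.norm_eq_abs] using norm_one_sub_cos_le (z * v)
    _ ≤ (‖z‖ * |v|) ^ 2 * Real.exp ‖z‖ := by gcongr
    _ = ‖z‖ ^ 2 * Real.exp ‖z‖ * v ^ 2 := by rw [mul_pow, sq_abs]; ring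

theorem differentiable_cosExpC (hs : ∀ᵐ v ∂ν, |v| ≤ 1)
    (hν : Integrable (fun v : ℝ => v ^ 2) ν) : Differentiable ℂ (cosExpC ν) := by
  intro z
  refine (hasDerivAt_integral_of_dominated_loc_of_deriv_le (μ := ν) (𝕜 := ℂ)
    (F := fun z (v : ℝ) => 1 - Complex.cos (z * v)) (F' := fun z (v : ℝ) => v * Complex.sin (z * v))
    (bound := fun v => ((‖z‖ + 1) * Real.exp (‖z‖ + 1)) * v ^ 2) (x₀ := z)
    (Metric.ball_mem_nhds z one_pos) (.of_forall fun _ => by fun_prop)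
    (integrable_one_sub_ccos hs hν z) (by fun_prop) ?_ (hν.const_mul _) ?_).2.differentiableAt
  · filter_upwards [hs] with v hv w hw
    have hw' : ‖w‖ ≤ ‖z‖ + 1 := by
      linarith [norm_le_norm_add_norm_sub' w z, mem_ball_iff_norm.1 hw]
    have hwv : ‖w‖ * |v| ≤ ‖z‖ + 1 :=
      (mul_le_of_le_one_right (norm_nonneg w) hv).trans hw'
    have hsin : ‖Complex.sin (w * v)‖ ≤ ‖w‖ * |v| * Real.exp (‖w‖ * |v|) := by
      simpa only [norm_mul, Complex.norm_real, Real.norm_eq_abs] using norm_sin_le (w * v)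
    calc ‖v * Complex.sin (w * v)‖ = |v| * ‖Complex.sin (w * v)‖ := by
          rw [norm_mul, Complex.norm_real, Real.norm_eq_abs]
      _ ≤ |v| * (‖w‖ * |v| * Real.exp (‖w‖ * |v|)) := by gcongr
      _ ≤ |v| * ((‖z‖ + 1) * |v| * Real.exp (‖z‖ + 1)) := by gcongr
      _ = (‖z‖ + 1) * Real.exp (‖z‖ + 1) * |v| ^ 2 := by ring
      _ = (‖z‖ + 1) * Real.exp (‖z‖ + 1) * v ^ 2 := by rw [sq_abs]
  · refine ae_of_all _ fun v w _ => ?_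
    refine (((Complex.hasDerivAt_cos (w * v)).comp w
      ((hasDerivAt_id w).mul_const (v : ℂ))).const_sub 1).congr_deriv ?_
    simp only [one_mul]
    ring

theorem re_one_sub_cos_add_mul_I (x y : ℝ) :
    (1 - Complex.cos (x + y * I)).re = 1 - Real.cos x * Real.cosh y := by
  simp only [Complex.cos_add_mul_I, ← Complex.ofReal_cos, ← Complex.ofReal_cosh,
    ← Complex.ofReal_sin, ← Complex.ofReal_sinh, ← Complex.ofReal_mul, Complex.sub_re,
    Complex.one_re, Complex.ofReal_re, Complex.re_ofReal_mul, Complex.I_re, mul_zero, sub_zero]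

theorem cosh_mul_sub_one_le {v : ℝ} (hv : |v| ≤ 1) (w : ℝ) :
    Real.cosh (w * v) - 1 ≤ 2 * Real.exp (2 * |w|) * v ^ 2 := by
  have hwv : |w * v| ≤ |w| := by
    rw [abs_mul]; exact mul_le_of_le_one_right (abs_nonneg _) hv
  have hsq : w ^ 2 ≤ 2 * Real.exp |w| := by
    have := Real.quadratic_le_exp_of_nonneg (abs_nonneg w)
    rw [sq_abs] at this
    linarith [abs_nonneg w]
  calc Real.cosh (w * v) - 1 ≤ (w * v) ^ 2 * Real.exp |w * v| := cosh_sub_one_le _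
    _ ≤ (w * v) ^ 2 * Real.exp |w| := by gcongr
    _ = w ^ 2 * Real.exp |w| * v ^ 2 := by ring
    _ ≤ 2 * Real.exp |w| * Real.exp |w| * v ^ 2 := by gcongr
    _ = 2 * Real.exp (2 * |w|) * v ^ 2 := by rw [two_mul |w|, Real.exp_add]; ring

theorem cosExp_sub_le_re_cosExpC (hs : ∀ᵐ v ∂ν, |v| ≤ 1) (hν : Integrable (fun v : ℝ => v ^ 2) ν)
    (η w : ℝ) :
    cosExp ν η - 2 * Real.exp (2 * |w|) * ∫ v : ℝ, v ^ 2 ∂ν ≤ (cosExpC ν (η + w * I)).re := by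
  have hre : (cosExpC ν (η + w * I)).re = ∫ v : ℝ, (1 - Complex.cos ((η + w * I) * v)).re ∂ν :=
    (integral_re (𝕜 := ℂ) (integrable_one_sub_ccos hs hν _)).symm
  rw [hre, cosExp, ← integral_const_mul,
    ← integral_sub (integrable_one_sub_cos hν η) (hν.const_mul _)]
  refine integral_mono_ae ((integrable_one_sub_cos hν η).sub (hν.const_mul _))
    (integrable_one_sub_ccos hs hν _).re ?_
  filter_upwards [hs] with v hv
  have hsplit : ((η : ℂ) + w * I) * v = ((η * v : ℝ) : ℂ) + ((w * v : ℝ) : ℂ) * I := by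
    push_cast; ring
  have hcos : Real.cos (η * v) * (Real.cosh (w * v) - 1) ≤ Real.cosh (w * v) - 1 :=
    mul_le_of_le_one_left (sub_nonneg.2 (Real.one_le_cosh _)) (Real.cos_le_one _)
  rw [hsplit, re_one_sub_cos_add_mul_I]
  linarith [cosh_mul_sub_one_le hv w]

end CosExp

/-! ### Rapid decay of the density of small jumps -/

/-- `ν` lives on `[-1, 1]`, has second moment at most `K`, and `exp (-cosExp ν)` decreases faster
than any power, at rates prescribed by `D`. This is what the rescaled small jumps of a process
satisfying condition **A** have in common, uniformly in time. -/
structure IsSmallJump (ν : Measure ℝ) (K : ℝ) (D : ℕ → ℝ) : Prop where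
  supp : ∀ᵐ v ∂ν, |v| ≤ 1
  integrable_sq : Integrable (fun v : ℝ => v ^ 2) ν
  integral_sq_le : ∫ v : ℝ, v ^ 2 ∂ν ≤ K
  decay : ∀ (k : ℕ) (η : ℝ), (1 + |η|) ^ k * Real.exp (-cosExp ν η) ≤ D k

/-- The entire extension of `η ↦ (-iη)ᵏ exp (-ixη - cosExp ν η)`, the integrand of Fourier inversion
for the `k`-th derivative at `x` of the density of small jumps. -/
noncomputable def jumpIntegrand (ν : Measure ℝ) (k : ℕ) (x : ℝ) (z : ℂ) : ℂ :=
  (-I * z) ^ k * Complex.exp (-I * x * z - cosExpC ν z)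

/-- The constant in front of the upper bound for the `k`-th derivative of the density of small
jumps. -/
noncomputable def jumpConst (K : ℝ) (D : ℕ → ℝ) (k : ℕ) : ℝ :=
  k.factorial * D (k + 2) / 2 *
    Real.exp (1 + ((2 * K + 1) * Real.exp (4 * (2 * K + 1)) + 2 * (2 * K + 1)))

section SmallJumpDecay

theorem one_add_abs_pow_le (k : ℕ) (w : ℝ) :
    (1 + |w|) ^ k ≤ k.factorial * Real.exp (1 + Real.exp (2 * |w|)) := by
  have hw : |w| ≤ Real.exp (2 * |w|) := by linarith [Real.add_one_le_exp (2 * |w|), abs_nonneg w]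
  have hpow := Real.pow_div_factorial_le_exp (1 + |w|) (by positivity) k
  rw [div_le_iff₀ (by positivity)] at hpow
  calc (1 + |w|) ^ k ≤ Real.exp (1 + |w|) * k.factorial := hpow
    _ ≤ Real.exp (1 + Real.exp (2 * |w|)) * k.factorial := by gcongr
    _ = _ := mul_comm _ _

theorem mul_le_sq_sub_one_mul_log {A s : ℝ} (hA : 0 ≤ A) (hs : 1 ≤ s) :
    A * s ≤ (s ^ 2 - 1) * Real.log s / 4 + (A * Real.exp (4 * A) + 2 * A) := by
  have hs2 : 0 ≤ s ^ 2 - 1 := sub_nonneg.2 (one_le_pow₀ hs)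
  rcases le_total (4 * A) (Real.log s) with h | h
  · have : 0 ≤ A * Real.exp (4 * A) := by positivity
    nlinarith [mul_le_mul_of_nonneg_left h hs2, mul_nonneg hA (sq_nonneg (s - 1))]
  · have hexp : s ≤ Real.exp (4 * A) := (Real.log_le_iff_le_exp (by linarith)).1 h
    have hlog : 0 ≤ (s ^ 2 - 1) * Real.log s := mul_nonneg hs2 (Real.log_nonneg hs)
    linarith [mul_le_mul_of_nonneg_left hexp hA]

theorem exists_mul_add_exp_le {A : ℝ} (hA : 0 ≤ A) (x : ℝ) :
    ∃ w : ℝ, w * x + A * Real.exp (2 * |w|) ≤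
      A * Real.exp (4 * A) + 2 * A - 1 / 8 * |x| * Real.log (1 + |x|) := by
  set s := Real.sqrt (1 + |x|)
  have hs1 : 1 ≤ s := Real.one_le_sqrt.2 (by linarith [abs_nonneg x])
  have hs2 : s ^ 2 = 1 + |x| := Real.sq_sqrt (by positivity)
  have hlog : Real.log (1 + |x|) = 2 * Real.log s := by rw [← hs2, Real.log_pow]; norm_num
  have hls : 0 ≤ Real.log s := Real.log_nonneg hs1
  -- The shift `|w| = log s / 2` makes `exp (2|w|) = (1 + |x|)^(1/2)` of lower order than `w x`.
  obtain ⟨w, hw, hwx⟩ : ∃ w : ℝ, |w| = Real.log s / 2 ∧ w * x = -(Real.log s / 2 * |x|) := by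
    rcases abs_cases x with ⟨hx, -⟩ | ⟨hx, -⟩
    · exact ⟨-(Real.log s / 2), by rw [abs_neg, abs_of_nonneg (by positivity)], by rw [hx]; ring⟩
    · exact ⟨Real.log s / 2, abs_of_nonneg (by positivity), by rw [hx]; ring⟩
  have hbound := mul_le_sq_sub_one_mul_log hA hs1
  rw [hs2] at hbound
  refine ⟨w, ?_⟩
  rw [hwx, hw, mul_div_cancel₀ _ two_ne_zero, Real.exp_log (zero_lt_one.trans_le hs1), hlog]
  linarith

theorem tendsto_inv_one_add_sq_cocompact :
    Tendsto (fun x : ℝ => (1 + x ^ 2)⁻¹) (cocompact ℝ) (𝓝 0) := by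
  refine tendsto_inv_atTop_zero.comp (tendsto_atTop_add_const_left _ _ ?_)
  simpa [Function.comp_def] using
    (tendsto_pow_atTop two_ne_zero).comp (tendsto_norm_cocompact_atTop (E := ℝ))

variable {ν : Measure ℝ} {K : ℝ} {D : ℕ → ℝ}

theorem IsSmallJump.one_le (h : IsSmallJump ν K D) (k : ℕ) : 1 ≤ D k := by
  simpa [cosExp] using h.decay k 0

theorem IsSmallJump.nonneg (h : IsSmallJump ν K D) : 0 ≤ K :=
  (integral_nonneg fun v => sq_nonneg v).trans h.integral_sq_le

theorem IsSmallJump.jumpConst_pos (h : IsSmallJump ν K D) (k : ℕ) : 0 < jumpConst K D k := by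
  have := h.one_le (k + 2)
  unfold jumpConst
  positivity

theorem IsSmallJump.pow_mul_exp_le (h : IsSmallJump ν K D) (k : ℕ) (η : ℝ) :
    (1 + |η|) ^ k * Real.exp (-cosExp ν η) ≤ D (k + 2) * (1 + η ^ 2)⁻¹ := by
  rw [← div_eq_mul_inv, le_div_iff₀ (by positivity)]
  have hsq : 1 + η ^ 2 ≤ (1 + |η|) ^ 2 := by nlinarith [sq_abs η, abs_nonneg η]
  calc (1 + |η|) ^ k * Real.exp (-cosExp ν η) * (1 + η ^ 2)
      ≤ (1 + |η|) ^ k * Real.exp (-cosExp ν η) * (1 + |η|) ^ 2 := by gcongr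
    _ = (1 + |η|) ^ (k + 2) * Real.exp (-cosExp ν η) := by ring
    _ ≤ D (k + 2) := h.decay (k + 2) η

theorem IsSmallJump.differentiable_jumpIntegrand (h : IsSmallJump ν K D) (k : ℕ) (x : ℝ) :
    Differentiable ℂ (jumpIntegrand ν k x) := by
  have := differentiable_cosExpC h.supp h.integrable_sq
  unfold jumpIntegrand
  fun_prop

theorem norm_jumpIntegrand_add_mul_I (ν : Measure ℝ) (k : ℕ) (x η w : ℝ) :
    ‖jumpIntegrand ν k x (η + w * I)‖ =
      ‖(η + w * I : ℂ)‖ ^ k * Real.exp (w * x - (cosExpC ν (η + w * I)).re) := by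
  have hre : (-I * x * (η + w * I)).re = w * x := by simp; ring
  rw [jumpIntegrand, norm_mul, norm_pow, norm_mul, norm_neg, Complex.norm_I, one_mul,
    Complex.norm_exp, Complex.sub_re, hre]

theorem IsSmallJump.norm_jumpIntegrand_le (h : IsSmallJump ν K D) (k : ℕ) (x η w : ℝ) :
    ‖jumpIntegrand ν k x (η + w * I)‖ ≤ k.factorial * D (k + 2) *
      Real.exp (1 + (w * x + (2 * K + 1) * Real.exp (2 * |w|))) * (1 + η ^ 2)⁻¹ := by
  have hnorm : ‖(η + w * I : ℂ)‖ ≤ (1 + |w|) * (1 + |η|) := by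
    refine (norm_add_le _ _).trans ?_
    rw [norm_mul, Complex.norm_I, mul_one, Complex.norm_real, Complex.norm_real, Real.norm_eq_abs,
      Real.norm_eq_abs]
    nlinarith [abs_nonneg w, abs_nonneg η]
  have hre : -(cosExpC ν (η + w * I)).re ≤ 2 * K * Real.exp (2 * |w|) - cosExp ν η := by
    nlinarith [cosExp_sub_le_re_cosExpC h.supp h.integrable_sq η w, h.integral_sq_le,
      Real.exp_pos (2 * |w|)]
  calc ‖jumpIntegrand ν k x (η + w * I)‖
      = ‖(η + w * I : ℂ)‖ ^ k * Real.exp (w * x - (cosExpC ν (η + w * I)).re) :=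
        norm_jumpIntegrand_add_mul_I ν k x η w
    _ ≤ ((1 + |w|) * (1 + |η|)) ^ k *
          Real.exp (w * x + 2 * K * Real.exp (2 * |w|) - cosExp ν η) := by
        gcongr ?_ ^ k * Real.exp ?_
        linarith
    _ = (1 + |w|) ^ k * Real.exp (w * x + 2 * K * Real.exp (2 * |w|)) *
          ((1 + |η|) ^ k * Real.exp (-cosExp ν η)) := by
        rw [mul_pow, sub_eq_add_neg, Real.exp_add _ (-cosExp ν η)]; ring
    _ ≤ (k.factorial * Real.exp (1 + Real.exp (2 * |w|))) *
          Real.exp (w * x + 2 * K * Real.exp (2 * |w|)) * (D (k + 2) * (1 + η ^ 2)⁻¹) := by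
        gcongr ?_ * _ * ?_
        exacts [one_add_abs_pow_le k w, h.pow_mul_exp_le k η]
    _ = k.factorial * D (k + 2) *
          (Real.exp (1 + Real.exp (2 * |w|)) * Real.exp (w * x + 2 * K * Real.exp (2 * |w|))) *
          (1 + η ^ 2)⁻¹ := by ring
    _ = _ := by rw [← Real.exp_add]; ring_nf

theorem IsSmallJump.integral_jumpIntegrand_eq_shift (h : IsSmallJump ν K D) (k : ℕ) (x w : ℝ) :
    ∫ η : ℝ, jumpIntegrand ν k x η = ∫ η : ℝ, jumpIntegrand ν k x (η + w * I) := by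
  have hK := h.nonneg
  have hD := zero_le_one.trans (h.one_le (k + 2))
  refine integral_eq_integral_add_mul_I (h.differentiable_jumpIntegrand k x)
    (g := fun η => k.factorial * D (k + 2) *
      Real.exp (1 + (|w| * |x| + (2 * K + 1) * Real.exp (2 * |w|))) * (1 + η ^ 2)⁻¹)
    (integrable_inv_one_add_sq.const_mul _) ?_ fun η y hy => ?_
  · simpa only [mul_zero] using tendsto_inv_one_add_sq_cocompact.const_mul _
  · have hyw : |y| ≤ |w| := by simpa using Set.abs_sub_left_of_mem_uIcc hy
    have hyx : y * x ≤ |w| * |x| := (le_abs_self _).trans (by rw [abs_mul]; gcongr)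
    refine (h.norm_jumpIntegrand_le k x η y).trans ?_
    gcongr

theorem IsSmallJump.norm_integral_jumpIntegrand_le (h : IsSmallJump ν K D) (k : ℕ) (x w : ℝ) :
    ‖∫ η : ℝ, jumpIntegrand ν k x η‖ ≤ k.factorial * D (k + 2) *
      Real.exp (1 + (w * x + (2 * K + 1) * Real.exp (2 * |w|))) * π := by
  rw [h.integral_jumpIntegrand_eq_shift k x w, ← integral_univ_inv_one_add_sq,
    ← integral_const_mul]
  exact norm_integral_le_of_norm_le (integrable_inv_one_add_sq.const_mul _)
    (ae_of_all _ fun η => h.norm_jumpIntegrand_le k x η w)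

theorem IsSmallJump.norm_integral_jumpIntegrand_le_fUpperSym (h : IsSmallJump ν K D) (k : ℕ)
    (x : ℝ) :
    (2 * π)⁻¹ * ‖∫ η : ℝ, jumpIntegrand ν k x η‖ ≤ fUpperSym (jumpConst K D k) (1 / 8) x := by
  have hD := zero_le_one.trans (h.one_le (k + 2))
  obtain ⟨w, hw⟩ := exists_mul_add_exp_le (A := 2 * K + 1) (by linarith [h.nonneg]) x
  calc (2 * π)⁻¹ * ‖∫ η : ℝ, jumpIntegrand ν k x η‖
      ≤ (2 * π)⁻¹ * (k.factorial * D (k + 2) *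
          Real.exp (1 + (w * x + (2 * K + 1) * Real.exp (2 * |w|))) * π) := by
        gcongr
        exact h.norm_integral_jumpIntegrand_le k x w
    _ = k.factorial * D (k + 2) / 2 *
          Real.exp (1 + (w * x + (2 * K + 1) * Real.exp (2 * |w|))) := by
        field_simp
    _ ≤ k.factorial * D (k + 2) / 2 *
          Real.exp (1 + ((2 * K + 1) * Real.exp (4 * (2 * K + 1)) + 2 * (2 * K + 1) -
            1 / 8 * |x| * Real.log (1 + |x|))) := by gcongr
    _ = fUpperSym (jumpConst K D k) (1 / 8) x := by
        rw [fUpperSym, jumpConst, mul_assoc _ (Real.exp _), ← Real.exp_add]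
        ring_nf

end SmallJumpDecay

/-! ### The density of small jumps -/

/-- The Fourier transform of the density of small jumps, in Mathlib's normalization
`f̂(η) = ∫ exp (-2πixη) f(x) dx`. -/
noncomputable def jumpFourier (ν : Measure ℝ) (η : ℝ) : ℂ :=
  Complex.exp (-cosExp ν (2 * π * η))

/-- The density of the infinitely divisible law with characteristic exponent `cosExp ν`. The real
part is taken only to have a real-valued function: `ofReal_jumpDensity`. -/
noncomputable def jumpDensity (ν : Measure ℝ) (x : ℝ) : ℝ := (𝓕 (jumpFourier ν) x).re

section JumpDensity

theorem iteratedDeriv_re {f : ℝ → ℂ} {k : ℕ} (hf : ContDiff ℝ k f) (x : ℝ) :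
    iteratedDeriv k (fun y => (f y).re) x = (iteratedDeriv k f x).re := by
  have h := Complex.reCLM.iteratedFDeriv_comp_left hf.contDiffAt (x := x) le_rfl
  exact DFunLike.congr_fun h fun _ => 1

variable {ν : Measure ℝ} {K : ℝ} {D : ℕ → ℝ}

theorem norm_jumpFourier (ν : Measure ℝ) (η : ℝ) :
    ‖jumpFourier ν η‖ = Real.exp (-cosExp ν (2 * π * η)) := by
  rw [jumpFourier, ← Complex.ofReal_neg, Complex.norm_exp_ofReal]

theorem norm_jumpFourier_le_one (ν : Measure ℝ) (η : ℝ) : ‖jumpFourier ν η‖ ≤ 1 := by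
  rw [norm_jumpFourier]
  exact Real.exp_le_one_iff.2 (neg_nonpos.2 (cosExp_nonneg _ _))

theorem IsSmallJump.continuous_cosExp (h : IsSmallJump ν K D) : Continuous (cosExp ν) := by
  have hc := (differentiable_cosExpC h.supp h.integrable_sq).continuous
  have heq : cosExp ν = fun η : ℝ => (cosExpC ν η).re := by
    ext η
    rw [cosExpC_ofReal, Complex.ofReal_re]
  rw [heq]
  fun_prop

theorem IsSmallJump.continuous_jumpFourier (h : IsSmallJump ν K D) :
    Continuous (jumpFourier ν) := by
  have := h.continuous_cosExp
  unfold jumpFourier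
  fun_prop

theorem IsSmallJump.integrable_norm_pow_mul_jumpFourier (h : IsSmallJump ν K D) (k : ℕ) :
    Integrable (fun η : ℝ => ‖η‖ ^ k * ‖jumpFourier ν η‖) := by
  have hc := h.continuous_jumpFourier
  have hmajorant := (integrable_inv_one_add_sq.const_mul (D (k + 2))).comp_mul_left'
    Real.two_pi_pos.ne'
  refine hmajorant.mono' (by fun_prop) (ae_of_all _ fun η => ?_)
  have hη : |η| ≤ 1 + |2 * π * η| := by
    rw [abs_mul, abs_of_pos Real.two_pi_pos]
    nlinarith [Real.pi_gt_three, abs_nonneg η]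
  rw [norm_mul, norm_pow, norm_norm, norm_norm, norm_jumpFourier, Real.norm_eq_abs]
  exact (by gcongr : _ ≤ (1 + |2 * π * η|) ^ k * _).trans (h.pow_mul_exp_le k (2 * π * η))

theorem IsSmallJump.integrable_pow_smul_jumpFourier (h : IsSmallJump ν K D) (k : ℕ) :
    Integrable (fun η : ℝ => η ^ k • jumpFourier ν η) := by
  have hc := h.continuous_jumpFourier
  refine (h.integrable_norm_pow_mul_jumpFourier k).mono' (by fun_prop) (ae_of_all _ fun η => ?_)
  rw [norm_smul, norm_pow]

theorem IsSmallJump.integrable_jumpFourier (h : IsSmallJump ν K D) :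
    Integrable (jumpFourier ν) := by
  simpa using h.integrable_pow_smul_jumpFourier 0

theorem IsSmallJump.contDiff_fourier (h : IsSmallJump ν K D) :
    ContDiff ℝ (⊤ : ℕ∞) (𝓕 (jumpFourier ν)) :=
  Real.contDiff_fourier fun n _ => h.integrable_norm_pow_mul_jumpFourier n

theorem IsSmallJump.contDiff_jumpDensity (h : IsSmallJump ν K D) :
    ContDiff ℝ (⊤ : ℕ∞) (jumpDensity ν) :=
  Complex.reCLM.contDiff.comp h.contDiff_fourier

theorem IsSmallJump.iteratedDeriv_fourier (h : IsSmallJump ν K D) (k : ℕ) (x : ℝ) :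
    iteratedDeriv k (𝓕 (jumpFourier ν)) x =
      ((2 * π)⁻¹ : ℝ) • ∫ η : ℝ, jumpIntegrand ν k x η := by
  rw [Real.iteratedDeriv_fourier (N := ⊤) (fun n _ => h.integrable_pow_smul_jumpFourier n) le_top,
    Real.fourier_real_eq_integral_exp_smul, ← abs_of_pos (inv_pos.2 Real.two_pi_pos),
    ← Measure.integral_comp_mul_left (fun η : ℝ => jumpIntegrand ν k x η)]
  refine integral_congr_ae (ae_of_all _ fun η => ?_)
  simp only [jumpIntegrand, jumpFourier, smul_eq_mul, cosExpC_ofReal]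
  rw [mul_left_comm, ← Complex.exp_add]
  push_cast
  ring_nf

theorem IsSmallJump.abs_iteratedDeriv_jumpDensity_le (h : IsSmallJump ν K D) (k : ℕ) (x : ℝ) :
    |iteratedDeriv k (jumpDensity ν) x| ≤ fUpperSym (jumpConst K D k) (1 / 8) x := by
  have hre : iteratedDeriv k (jumpDensity ν) x = (iteratedDeriv k (𝓕 (jumpFourier ν)) x).re :=
    iteratedDeriv_re (h.contDiff_fourier.of_le (by exact_mod_cast le_top)) x
  calc |iteratedDeriv k (jumpDensity ν) x|
      ≤ ‖((2 * π)⁻¹ : ℝ) • ∫ η : ℝ, jumpIntegrand ν k x η‖ := by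
        rw [hre, h.iteratedDeriv_fourier]
        exact Complex.abs_re_le_norm _
    _ = (2 * π)⁻¹ * ‖∫ η : ℝ, jumpIntegrand ν k x η‖ := by
        rw [norm_smul, Real.norm_of_nonneg (by positivity)]
    _ ≤ fUpperSym (jumpConst K D k) (1 / 8) x := h.norm_integral_jumpIntegrand_le_fUpperSym k x

end JumpDensity

/-! ### Symmetric measures -/

section IsNegInvariant

theorem isNegInvariant_restrict {G : Type*} [MeasurableSpace G] [InvolutiveNeg G] [MeasurableNeg G]
    {ν : Measure G} [ν.IsNegInvariant] {s : Set G} (hs : -s = s) :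
    (ν.restrict s).IsNegInvariant := by
  refine ⟨(?_ : (ν.restrict s).map Neg.neg = _)⟩
  have h := (Measure.measurePreserving_neg ν).restrict_preimage_emb
    (MeasurableEquiv.neg G).measurableEmbedding s
  rw [Set.neg_preimage, hs] at h
  exact h.map_eq

theorem isNegInvariant_smul {G : Type*} [MeasurableSpace G] [Neg G] (ν : Measure G)
    [ν.IsNegInvariant] (c : ℝ≥0∞) : (c • ν).IsNegInvariant :=
  ⟨by rw [Measure.neg, Measure.map_smul, Measure.map_neg_eq_self]⟩

theorem isNegInvariant_map_const_mul {R : Type*} [MeasurableSpace R] [Mul R] [HasDistribNeg R]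
    [MeasurableNeg R] [MeasurableMul R] (ν : Measure R) [ν.IsNegInvariant] (c : R) :
    (ν.map (c * ·)).IsNegInvariant := by
  refine ⟨?_⟩
  have hcomm : (Neg.neg ∘ (c * ·) : R → R) = (c * ·) ∘ Neg.neg := by
    ext r
    simp
  rw [Measure.neg, Measure.map_map measurable_neg (measurable_const_mul c), hcomm,
    ← Measure.map_map (measurable_const_mul c) measurable_neg, Measure.map_neg_eq_self]

theorem re_charFun (Q : Measure ℝ) [IsFiniteMeasure Q] (ξ : ℝ) :
    (charFun Q ξ).re = Q.real Set.univ - cosExp Q ξ := by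
  have hcos : Integrable (fun v : ℝ => Real.cos (ξ * v)) Q :=
    .of_bound (by fun_prop) 1 (ae_of_all _ fun v => Real.abs_cos_le_one _)
  have hre : (charFun Q ξ).re = ∫ v : ℝ, Real.cos (ξ * v) ∂Q := by
    rw [charFun_apply_real]
    refine (integral_re (𝕜 := ℂ) (integrable_cexp_mul_I Q ξ)).symm.trans ?_
    refine integral_congr_ae (ae_of_all _ fun v => ?_)
    change (Complex.exp (ξ * v * I)).re = _
    rw [← Complex.ofReal_mul, Complex.exp_ofReal_mul_I_re]
  rw [hre, cosExp, integral_sub (integrable_const _) hcos, integral_const, smul_eq_mul, mul_one,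
    sub_sub_cancel]

theorem charFun_of_isNegInvariant (Q : Measure ℝ) [IsFiniteMeasure Q] [Q.IsNegInvariant] (ξ : ℝ) :
    charFun Q ξ = ((Q.real Set.univ - cosExp Q ξ : ℝ) : ℂ) := by
  have hneg : charFun Q (-ξ) = charFun Q ξ := by
    have h := charFun_map_mul (μ := Q) (-1) ξ
    simp only [neg_mul, one_mul] at h
    rw [← h]
    exact congrArg (charFun · ξ) Q.map_neg_eq_self
  rw [charFun_neg] at hneg
  rw [← re_charFun, Complex.conj_eq_iff_re.1 hneg]

end IsNegInvariant

/-! ### Positivity of the density of small jumps -/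

section Positivity

variable {ν : Measure ℝ} {K : ℝ} {D : ℕ → ℝ}

theorem fourier_mul_charFun {g : ℝ → ℂ} (hg : Integrable g) (E : Measure ℝ) [IsFiniteMeasure E]
    (x : ℝ) : 𝓕 (fun η => g η * charFun E (2 * π * η)) x = ∫ y, 𝓕 g (x - y) ∂E := by
  simp only [Real.fourier_real_eq_integral_exp_smul, smul_eq_mul]
  rw [← integral_integral_swap]
  · refine integral_congr_ae (ae_of_all _ fun η => ?_)
    simp only [charFun_apply_real]
    rw [← integral_const_mul, ← integral_const_mul]
    refine integral_congr_ae (ae_of_all _ fun y => ?_)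
    simp only
    rw [mul_left_comm, ← Complex.exp_add, mul_comm]
    push_cast
    ring_nf
  · have hg' := hg.comp_fst E
    refine hg'.mono (.mul (by fun_prop) hg'.1) (ae_of_all _ fun p => ?_)
    rw [Function.uncurry, norm_mul, Complex.norm_exp_ofReal_mul_I, one_mul]

theorem norm_cexp_neg_pi_mul_sq (δ η : ℝ) :
    ‖Complex.exp (-π * δ * η ^ 2)‖ = Real.exp (-(π * δ) * η ^ 2) := by
  rw [← Complex.norm_exp_ofReal]
  push_cast
  ring_nf

theorem integrable_cexp_neg_pi_mul_sq {δ : ℝ} (hδ : 0 < δ) :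
    Integrable fun η : ℝ => Complex.exp (-π * δ * η ^ 2) :=
  (integrable_exp_neg_mul_sq (mul_pos Real.pi_pos hδ)).mono' (by fun_prop)
    (ae_of_all _ fun η => (norm_cexp_neg_pi_mul_sq δ η).le)

open scoped ComplexOrder in
theorem fourier_gaussian_nonneg {δ : ℝ} (hδ : 0 < δ) (x : ℝ) :
    0 ≤ 𝓕 (fun η : ℝ => Complex.exp (-π * δ * η ^ 2)) x := by
  have hreal : 𝓕 (fun η : ℝ => Complex.exp (-π * δ * η ^ 2)) x =
      ((1 / δ ^ (1 / 2 : ℝ) * Real.exp (-π / δ * x ^ 2) : ℝ) : ℂ) := by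
    rw [fourier_gaussian_pi (by simpa using hδ)]
    push_cast [Complex.ofReal_cpow hδ.le]
    rfl
  rw [hreal, Complex.zero_le_real]
  positivity

open scoped ComplexOrder in
theorem fourier_gaussian_mul_charFun_nonneg (E : Measure ℝ) [IsFiniteMeasure E] {δ : ℝ}
    (hδ : 0 < δ) (x : ℝ) :
    0 ≤ 𝓕 (fun η : ℝ => Complex.exp (-π * δ * η ^ 2) * charFun E (2 * π * η)) x := by
  rw [fourier_mul_charFun (integrable_cexp_neg_pi_mul_sq hδ)]
  exact integral_nonneg fun y => fourier_gaussian_nonneg hδ _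

open scoped ComplexOrder in
theorem fourier_nonneg_of_tendsto {F : ℕ → ℝ → ℂ} {f : ℝ → ℂ} {bound : ℝ → ℝ} {x : ℝ}
    (hF : ∀ n, AEStronglyMeasurable (F n)) (hbound : Integrable bound)
    (hle : ∀ n η, ‖F n η‖ ≤ bound η) (hlim : ∀ η, Tendsto (F · η) atTop (𝓝 (f η)))
    (hnonneg : ∀ n, 0 ≤ 𝓕 (F n) x) : 0 ≤ 𝓕 f x := by
  simp only [Real.fourier_real_eq_integral_exp_smul] at hnonneg ⊢
  refine ge_of_tendsto' (tendsto_integral_of_dominated_convergence bound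
    (fun n => .smul (by fun_prop) (hF n)) hbound (fun n => ae_of_all _ fun η => ?_)
    (ae_of_all _ fun η => (hlim η).const_smul _)) hnonneg
  rw [Pi.smul_apply', norm_smul, Complex.norm_exp_ofReal_mul_I, one_mul]
  exact hle n η

theorem jumpFourier_eq_mul_charFun_convExp (Q : Measure ℝ) [IsFiniteMeasure Q] [Q.IsNegInvariant]
    (η : ℝ) :
    jumpFourier Q η = Real.exp (-Q.real Set.univ) * charFun (convExp Q) (2 * π * η) := by
  rw [charFun_convExp, charFun_of_isNegInvariant, Complex.ofReal_exp, ← Complex.exp_add,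
    jumpFourier]
  push_cast
  ring_nf

theorem continuous_jumpFourier_of_isFiniteMeasure (Q : Measure ℝ) [IsFiniteMeasure Q]
    [Q.IsNegInvariant] : Continuous (jumpFourier Q) := by
  rw [funext (jumpFourier_eq_mul_charFun_convExp Q)]
  fun_prop

open scoped ComplexOrder in
theorem fourier_gaussian_mul_jumpFourier_nonneg_of_isFiniteMeasure (Q : Measure ℝ)
    [IsFiniteMeasure Q] [Q.IsNegInvariant] {δ : ℝ} (hδ : 0 < δ) (x : ℝ) :
    0 ≤ 𝓕 (fun η : ℝ => Complex.exp (-π * δ * η ^ 2) * jumpFourier Q η) x := by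
  have hnonneg := mul_nonneg (Complex.zero_le_real.2 (Real.exp_nonneg (-Q.real Set.univ)))
    (fourier_gaussian_mul_charFun_nonneg (convExp Q) hδ x)
  simp only [Real.fourier_real_eq_integral_exp_smul, smul_eq_mul] at hnonneg ⊢
  rw [← integral_const_mul] at hnonneg
  refine hnonneg.trans_eq (integral_congr_ae (ae_of_all _ fun η => ?_))
  simp only [jumpFourier_eq_mul_charFun_convExp]
  ring

theorem isFiniteMeasure_restrict_lt_abs (hν : Integrable (fun v : ℝ => v ^ 2) ν) {ε : ℝ}
    (hε : 0 < ε) : IsFiniteMeasure (ν.restrict {v | ε < |v|}) := by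
  refine ⟨?_⟩
  rw [Measure.restrict_apply_univ]
  refine (measure_mono fun v (hv : ε < |v|) => ?_).trans_lt
    (hν.measure_norm_ge_lt_top (pow_pos hε 2))
  change ε ^ 2 ≤ ‖v ^ 2‖
  rw [norm_pow, Real.norm_eq_abs]
  gcongr

theorem tendsto_cosExp_restrict_lt_abs (hν : Integrable (fun v : ℝ => v ^ 2) ν) (η : ℝ) :
    Tendsto (fun n : ℕ => cosExp (ν.restrict {v | 1 / ((n : ℝ) + 1) < |v|}) η) atTop
      (𝓝 (cosExp ν η)) := by
  have hmono : Monotone fun n : ℕ => {v : ℝ | 1 / ((n : ℝ) + 1) < |v|} := fun m n hmn v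
      (hv : 1 / ((m : ℝ) + 1) < |v|) => show 1 / ((n : ℝ) + 1) < |v| from
    (Nat.one_div_le_one_div hmn).trans_lt hv
  have hlim := tendsto_setIntegral_of_monotone
    (fun n => measurableSet_lt measurable_const measurable_abs) hmono
    (integrable_one_sub_cos hν η).integrableOn
  rwa [setIntegral_eq_integral_of_forall_compl_eq_zero fun v hv => ?_] at hlim
  have hv0 : v = 0 := by
    by_contra h
    obtain ⟨n, hn⟩ := exists_nat_one_div_lt (abs_pos.2 h)
    exact hv (Set.mem_iUnion.2 ⟨n, hn⟩)
  simp [hv0]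

open scoped ComplexOrder in
theorem fourier_gaussian_mul_jumpFourier_nonneg [ν.IsNegInvariant]
    (hν : Integrable (fun v : ℝ => v ^ 2) ν) {δ : ℝ} (hδ : 0 < δ) (x : ℝ) :
    0 ≤ 𝓕 (fun η : ℝ => Complex.exp (-π * δ * η ^ 2) * jumpFourier ν η) x := by
  let Q (n : ℕ) : Measure ℝ := ν.restrict {v | 1 / ((n : ℝ) + 1) < |v|}
  have hQ (n : ℕ) : IsFiniteMeasure (Q n) := isFiniteMeasure_restrict_lt_abs hν (by positivity)
  have hQsymm (n : ℕ) : (Q n).IsNegInvariant := isNegInvariant_restrict (by ext; simp)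
  have hlim (η : ℝ) : Tendsto (fun n => jumpFourier (Q n) η) atTop (𝓝 (jumpFourier ν η)) :=
    (Complex.continuous_exp.tendsto _).comp
      ((Complex.continuous_ofReal.tendsto _).comp (tendsto_cosExp_restrict_lt_abs hν _)).neg
  refine fourier_nonneg_of_tendsto (fun n => ?_)
    (integrable_exp_neg_mul_sq (mul_pos Real.pi_pos hδ)) (fun n η => ?_)
    (fun η => (hlim η).const_mul _)
    (fun n => fourier_gaussian_mul_jumpFourier_nonneg_of_isFiniteMeasure (Q n) hδ x)
  · have := continuous_jumpFourier_of_isFiniteMeasure (Q n)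
    fun_prop
  · rw [norm_mul, norm_cexp_neg_pi_mul_sq]
    exact mul_le_of_le_one_right (Real.exp_nonneg _) (norm_jumpFourier_le_one _ _)

variable [ν.IsNegInvariant]

open scoped ComplexOrder in
theorem IsSmallJump.fourier_nonneg (h : IsSmallJump ν K D) (x : ℝ) :
    0 ≤ 𝓕 (jumpFourier ν) x := by
  have hc := h.continuous_jumpFourier
  refine fourier_nonneg_of_tendsto (fun n => by fun_prop) h.integrable_jumpFourier.norm
    (fun n η => ?_) (fun η => ?_) (fun n => fourier_gaussian_mul_jumpFourier_nonneg h.integrable_sq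
      (δ := 1 / ((n : ℝ) + 1)) (by positivity) x)
  · rw [norm_mul, norm_cexp_neg_pi_mul_sq]
    refine mul_le_of_le_one_left (norm_nonneg _) (Real.exp_le_one_iff.2 ?_)
    rw [neg_mul, neg_nonpos]
    positivity
  · have hδ : Tendsto (fun n : ℕ => ((1 / ((n : ℝ) + 1) : ℝ) : ℂ)) atTop (𝓝 ((0 : ℝ) : ℂ)) :=
      (Complex.continuous_ofReal.tendsto _).comp tendsto_one_div_add_atTop_nhds_zero_nat
    have hcont : Continuous fun z : ℂ => Complex.exp (-π * z * η ^ 2) * jumpFourier ν η := by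
      fun_prop
    simpa [Function.comp_def] using (hcont.tendsto _).comp hδ

theorem IsSmallJump.ofReal_jumpDensity (h : IsSmallJump ν K D) (x : ℝ) :
    (jumpDensity ν x : ℂ) = 𝓕 (jumpFourier ν) x :=
  (Complex.eq_re_of_ofReal_le (r := 0) (by simpa using h.fourier_nonneg x)).symm

theorem IsSmallJump.jumpDensity_nonneg (h : IsSmallJump ν K D) (x : ℝ) : 0 ≤ jumpDensity ν x :=
  (Complex.le_def.1 (h.fourier_nonneg x)).1

end Positivity

/-! ### Lower bound and characteristic function of the density of small jumps -/

section LowerBound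

variable {ν : Measure ℝ} {K : ℝ} {D : ℕ → ℝ}

theorem fUpperSym_nonneg {b₁ : ℝ} (h₁ : 0 ≤ b₁) (b₂ x : ℝ) : 0 ≤ fUpperSym b₁ b₂ x :=
  mul_nonneg h₁ (Real.exp_nonneg _)

theorem log_one_add_abs_nonneg (x : ℝ) : 0 ≤ Real.log (1 + |x|) :=
  Real.log_nonneg (le_add_of_nonneg_right (abs_nonneg x))

theorem fUpperSym_le {b₁ b₂ : ℝ} (h₁ : 0 ≤ b₁) (h₂ : 0 ≤ b₂) (x : ℝ) : fUpperSym b₁ b₂ x ≤ b₁ := by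
  refine mul_le_of_le_one_right h₁ (Real.exp_le_one_iff.2 ?_)
  rw [neg_mul, neg_mul, neg_nonpos]
  have := log_one_add_abs_nonneg x
  positivity

theorem continuous_fUpperSym (b₁ b₂ : ℝ) : Continuous (fUpperSym b₁ b₂) := by
  have hlog : Continuous fun x : ℝ => Real.log (1 + |x|) :=
    Continuous.log (by fun_prop) fun x => by positivity
  unfold fUpperSym
  fun_prop

theorem abs_sub_exp_le_mul_log {b : ℝ} (hb : 0 < b) (x : ℝ) :
    |x| - Real.exp (1 / b) ≤ b * |x| * Real.log (1 + |x|) := by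
  have hlog := log_one_add_abs_nonneg x
  rcases le_total (1 / b) (Real.log (1 + |x|)) with h | h
  · calc |x| - Real.exp (1 / b) ≤ |x| := sub_le_self _ (Real.exp_nonneg _)
      _ = b * |x| * (1 / b) := by field_simp
      _ ≤ b * |x| * Real.log (1 + |x|) := by gcongr
  · have hx : 1 + |x| ≤ Real.exp (1 / b) := (Real.log_le_iff_le_exp (by positivity)).1 h
    have : 0 ≤ b * |x| * Real.log (1 + |x|) := by positivity
    linarith

theorem exp_neg_abs_le (x : ℝ) : Real.exp (-|x|) ≤ 2 * (1 + x ^ 2)⁻¹ := by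
  have h := Real.quadratic_le_exp_of_nonneg (abs_nonneg x)
  rw [sq_abs] at h
  rw [Real.exp_neg, ← div_eq_mul_inv, inv_le_comm₀ (Real.exp_pos _) (by positivity), inv_div]
  linarith [abs_nonneg x]

theorem integrable_fUpperSym (b₁ : ℝ) {b₂ : ℝ} (h₂ : 0 < b₂) : Integrable (fUpperSym b₁ b₂) := by
  have hfactor : fUpperSym b₁ b₂ = fun x => b₁ * fUpperSym 1 b₂ x := by
    ext x
    rw [fUpperSym, fUpperSym, one_mul]
  rw [hfactor]
  refine Integrable.const_mul ((integrable_inv_one_add_sq.const_mul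
    (Real.exp (Real.exp (1 / b₂)) * 2)).mono'
      (continuous_fUpperSym 1 b₂).aestronglyMeasurable (ae_of_all _ fun x => ?_)) b₁
  rw [Real.norm_of_nonneg (fUpperSym_nonneg zero_le_one _ _), fUpperSym, one_mul]
  calc Real.exp (-b₂ * |x| * Real.log (1 + |x|)) ≤ Real.exp (Real.exp (1 / b₂) + -|x|) :=
        Real.exp_le_exp.2 (by linarith [abs_sub_exp_le_mul_log h₂ x])
    _ = Real.exp (Real.exp (1 / b₂)) * Real.exp (-|x|) := Real.exp_add _ _
    _ ≤ Real.exp (Real.exp (1 / b₂)) * (2 * (1 + x ^ 2)⁻¹) := by gcongr; exact exp_neg_abs_le x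
    _ = Real.exp (Real.exp (1 / b₂)) * 2 * (1 + x ^ 2)⁻¹ := (mul_assoc _ _ _).symm

theorem IsSmallJump.abs_jumpDensity_le (h : IsSmallJump ν K D) (x : ℝ) :
    |jumpDensity ν x| ≤ fUpperSym (jumpConst K D 0) (1 / 8) x := by
  simpa using h.abs_iteratedDeriv_jumpDensity_le 0 x

theorem IsSmallJump.integrable_jumpDensity (h : IsSmallJump ν K D) :
    Integrable (jumpDensity ν) :=
  (integrable_fUpperSym (jumpConst K D 0) (b₂ := 1 / 8) (by norm_num)).mono'
    h.contDiff_jumpDensity.continuous.aestronglyMeasurable (ae_of_all _ h.abs_jumpDensity_le)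

theorem IsSmallJump.abs_iteratedDeriv_jumpDensity_le_jumpConst (h : IsSmallJump ν K D) (k : ℕ)
    (x : ℝ) : |iteratedDeriv k (jumpDensity ν) x| ≤ jumpConst K D k :=
  (h.abs_iteratedDeriv_jumpDensity_le k x).trans
    (fUpperSym_le (h.jumpConst_pos k).le (by norm_num) x)

theorem IsSmallJump.abs_jumpDensity_sub_le (h : IsSmallJump ν K D) (x : ℝ) :
    |jumpDensity ν x - jumpDensity ν 0| ≤ jumpConst K D 1 * |x| := by
  simpa using convex_univ.norm_image_sub_le_of_norm_deriv_le
    (fun y _ => (h.contDiff_jumpDensity.differentiable (by simp)).differentiableAt)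
    (fun y _ => by simpa using h.abs_iteratedDeriv_jumpDensity_le_jumpConst 1 y)
    (Set.mem_univ 0) (Set.mem_univ x)

variable [ν.IsNegInvariant]

theorem IsSmallJump.integral_cexp_mul_jumpDensity (h : IsSmallJump ν K D) (ξ : ℝ) :
    ∫ x : ℝ, Complex.exp (ξ * x * I) * jumpDensity ν x = Complex.exp (-cosExp ν ξ) := by
  have hi : Integrable (𝓕 (jumpFourier ν)) :=
    h.integrable_jumpDensity.ofReal.congr (ae_of_all _ h.ofReal_jumpDensity)
  have hinv := congrFun
    (h.continuous_jumpFourier.fourierInv_fourier_eq h.integrable_jumpFourier hi) (ξ / (2 * π))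
  rw [Real.fourierInv_eq', jumpFourier, mul_div_cancel₀ _ Real.two_pi_pos.ne'] at hinv
  rw [← hinv]
  refine integral_congr_ae (ae_of_all _ fun x => ?_)
  have hphase : 2 * π * inner ℝ x (ξ / (2 * π)) = ξ * x := by
    rw [RCLike.inner_apply, conj_trivial]
    field_simp
  simp only [h.ofReal_jumpDensity, smul_eq_mul, hphase, Complex.ofReal_mul]

/-- The maximum `1 / √(2πv)` of the centred Gaussian density of variance `v`, in the shape in which
`integral_gaussian` produces it. It bounds `jumpDensity ν 0` from below. -/
noncomputable def gaussianPeak (v : ℝ) : ℝ := √(π / (2 * π ^ 2 * v))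

theorem gaussianPeak_pos {v : ℝ} (hv : 0 < v) : 0 < gaussianPeak v :=
  Real.sqrt_pos.2 (by positivity)

theorem IsSmallJump.jumpDensity_zero (h : IsSmallJump ν K D) :
    jumpDensity ν 0 = ∫ η : ℝ, Real.exp (-cosExp ν (2 * π * η)) := by
  rw [← Complex.ofReal_inj, h.ofReal_jumpDensity, Real.fourier_real_eq_integral_exp_smul,
    ← integral_complex_ofReal]
  simp [jumpFourier]

theorem IsSmallJump.gaussianPeak_le_jumpDensity_zero (h : IsSmallJump ν K D) :
    gaussianPeak (K + 1) ≤ jumpDensity ν 0 := by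
  have hK := h.nonneg
  rw [h.jumpDensity_zero, gaussianPeak, ← integral_gaussian]
  refine integral_mono (integrable_exp_neg_mul_sq (by positivity))
    (h.integrable_jumpFourier.norm.congr (ae_of_all _ (norm_jumpFourier ν)))
    fun η => Real.exp_le_exp.2 ?_
  rw [neg_mul, neg_le_neg_iff]
  calc cosExp ν (2 * π * η) ≤ (2 * π * η) ^ 2 / 2 * ∫ v : ℝ, v ^ 2 ∂ν := cosExp_le h.integrable_sq _
    _ ≤ (2 * π * η) ^ 2 / 2 * (K + 1) := by
      gcongr
      exact h.integral_sq_le.trans (by linarith)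
    _ = 2 * π ^ 2 * (K + 1) * η ^ 2 := by ring

theorem IsSmallJump.fLower_le_jumpDensity (h : IsSmallJump ν K D) (x : ℝ) :
    fLower (gaussianPeak (K + 1) / 2) (gaussianPeak (K + 1) / (2 * jumpConst K D 1)) x ≤
      jumpDensity ν x := by
  have hM := h.jumpConst_pos 1
  rw [fLower]
  split_ifs with hx
  · rw [le_div_iff₀ (by positivity)] at hx
    linarith [(abs_le.1 (h.abs_jumpDensity_sub_le x)).1, h.gaussianPeak_le_jumpDensity_zero]
  · simpa using h.jumpDensity_nonneg x

end LowerBound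

/-! ### Convolution of a rescaled function with a finite measure -/

/-- The convolution of the rescaled function `x ↦ G (ρx)` with the measure `E`. With
`E = convExp Q` it is the sum of a compound kernel: `hasSum_compoundTerm`. -/
noncomputable def scaledConv (G : ℝ → ℝ) (ρ : ℝ) (E : Measure ℝ) (x : ℝ) : ℝ :=
  ∫ y : ℝ, G ((x - y) * ρ) ∂E

section ScaledConv

theorem contDiff_one_iteratedDeriv {G : ℝ → ℝ} (hG : ContDiff ℝ (⊤ : ℕ∞) G) (k : ℕ) :
    ContDiff ℝ 1 (iteratedDeriv k G) := by
  rw [iteratedDeriv_eq_iterate]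
  exact ContDiff.iterate_deriv' 1 k (hG.of_le (by exact_mod_cast le_top))

variable {G : ℝ → ℝ} {E : Measure ℝ} [IsFiniteMeasure E]

theorem integrable_comp_sub_mul {M : ℝ} (hG : Measurable G) (hM : ∀ x, |G x| ≤ M) (ρ x : ℝ) :
    Integrable (fun y : ℝ => G ((x - y) * ρ)) E :=
  .of_bound (hG.comp (by fun_prop)).aestronglyMeasurable M (ae_of_all _ fun _ => hM _)

theorem hasDerivAt_scaledConv (hG : ContDiff ℝ 1 G) {M M' : ℝ} (hM : ∀ x, |G x| ≤ M)
    (hM' : ∀ x, |deriv G x| ≤ M') (ρ x : ℝ) :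
    HasDerivAt (scaledConv G ρ E) (ρ * scaledConv (deriv G) ρ E x) x := by
  have hc := hG.continuous
  have := hG.continuous_deriv le_rfl
  have hderiv (x y : ℝ) :
      HasDerivAt (fun x => G ((x - y) * ρ)) (ρ * deriv G ((x - y) * ρ)) x := by
    have hinner : HasDerivAt (fun x => (x - y) * ρ) ρ x := by
      simpa using ((hasDerivAt_id x).sub_const y).mul_const ρ
    have houter := ((hG.differentiable one_ne_zero) ((x - y) * ρ)).hasDerivAt
    exact (houter.comp x hinner).congr_deriv (mul_comm _ _)
  rw [scaledConv, ← integral_const_mul]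
  refine (hasDerivAt_integral_of_dominated_loc_of_deriv_le (bound := fun _ => |ρ| * M')
    univ_mem (.of_forall fun _ => by fun_prop) (integrable_comp_sub_mul hc.measurable hM ρ x)
    (by fun_prop) (ae_of_all _ fun y x _ => ?_) (integrable_const _)
    (ae_of_all _ fun y x _ => hderiv x y)).2
  rw [Real.norm_eq_abs, abs_mul]
  gcongr
  exact hM' _

section Smooth

variable (hG : ContDiff ℝ (⊤ : ℕ∞) G) {M : ℕ → ℝ} (hM : ∀ k x, |iteratedDeriv k G x| ≤ M k)
include hG hM

theorem hasDerivAt_scaledConv_iteratedDeriv (ρ : ℝ) (k : ℕ) (x : ℝ) :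
    HasDerivAt (scaledConv (iteratedDeriv k G) ρ E)
      (ρ * scaledConv (iteratedDeriv (k + 1) G) ρ E x) x := by
  have hM' := hM (k + 1)
  rw [iteratedDeriv_succ] at hM' ⊢
  exact hasDerivAt_scaledConv (contDiff_one_iteratedDeriv hG k) (hM k) hM' ρ x

theorem iteratedDeriv_scaledConv (ρ : ℝ) (k : ℕ) :
    iteratedDeriv k (scaledConv G ρ E) =
      fun x => ρ ^ k * scaledConv (iteratedDeriv k G) ρ E x := by
  induction k with
  | zero =>
    ext x
    rw [iteratedDeriv_zero, iteratedDeriv_zero, pow_zero, one_mul]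
  | succ k ih =>
    ext x
    rw [iteratedDeriv_succ, ih,
      ((hasDerivAt_scaledConv_iteratedDeriv hG hM ρ k x).const_mul (ρ ^ k)).deriv]
    ring

theorem contDiff_scaledConv (ρ : ℝ) : ContDiff ℝ (⊤ : ℕ∞) (scaledConv G ρ E) := by
  refine contDiff_of_differentiable_iteratedDeriv fun k _ => ?_
  rw [iteratedDeriv_scaledConv hG hM]
  exact fun x =>
    ((hasDerivAt_scaledConv_iteratedDeriv hG hM ρ k x).const_mul (ρ ^ k)).differentiableAt

end Smooth

theorem integrable_prod_comp_sub_mul (hG : Integrable G) {ρ : ℝ} (hρ : ρ ≠ 0) :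
    Integrable (fun p : ℝ × ℝ => G ((p.1 - p.2) * ρ)) (volume.prod E) := by
  simpa using (integrable_const (μ := E) (1 : ℝ)).convolution_integrand
    (ContinuousLinearMap.mul ℝ ℝ) (hG.comp_mul_right' hρ)

theorem integrable_scaledConv (hG : Integrable G) {ρ : ℝ} (hρ : ρ ≠ 0) :
    Integrable (scaledConv G ρ E) :=
  (integrable_prod_comp_sub_mul hG hρ).integral_prod_left

theorem integral_cexp_mul_comp_sub_mul (G : ℝ → ℝ) {ρ : ℝ} (hρ : 0 < ρ) (ξ y : ℝ) :
    ∫ x : ℝ, Complex.exp (ξ * x * I) * (ρ * G ((x - y) * ρ)) =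
      (∫ x : ℝ, Complex.exp ((ξ / ρ : ℝ) * x * I) * G x) * Complex.exp (ξ * y * I) := by
  have hρ' : (ρ : ℂ) ≠ 0 := by exact_mod_cast hρ.ne'
  let g (r : ℝ) : ℂ := Complex.exp ((ξ / ρ : ℝ) * r * I) * G r
  have hfactor (x : ℝ) : Complex.exp (ξ * x * I) * (ρ * G ((x - y) * ρ)) =
      ρ * Complex.exp (ξ * y * I) * g ((x - y) * ρ) := by
    have hexp : Complex.exp (ξ * x * I) = Complex.exp (ξ * y * I) *
        Complex.exp ((ξ / ρ : ℝ) * ((x - y) * ρ : ℝ) * I) := by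
      rw [← Complex.exp_add]
      push_cast
      field_simp
      ring_nf
    rw [hexp]
    ring
  simp only [hfactor]
  rw [integral_const_mul, integral_sub_right_eq_self (fun s => g (s * ρ)),
    Measure.integral_comp_mul_right, abs_of_pos (inv_pos.2 hρ), Complex.real_smul]
  change _ = (∫ r, g r) * _
  push_cast
  field_simp

theorem integral_cexp_mul_scaledConv (hG : Integrable G) {ρ : ℝ} (hρ : 0 < ρ) (ξ : ℝ) :
    ∫ x : ℝ, Complex.exp (ξ * x * I) * ((ρ * scaledConv G ρ E x : ℝ) : ℂ) =
      (∫ x : ℝ, Complex.exp ((ξ / ρ : ℝ) * x * I) * G x) * charFun E ξ := by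
  have hinner (x : ℝ) : Complex.exp (ξ * x * I) * ((ρ * scaledConv G ρ E x : ℝ) : ℂ) =
      ∫ y : ℝ, Complex.exp (ξ * x * I) * (ρ * G ((x - y) * ρ)) ∂E := by
    rw [integral_const_mul, integral_const_mul, integral_complex_ofReal, scaledConv,
      Complex.ofReal_mul]
  rw [integral_congr_ae (ae_of_all _ hinner), integral_integral_swap]
  · simp only [integral_cexp_mul_comp_sub_mul G hρ, integral_const_mul, charFun_apply_real]
  · exact (((integrable_prod_comp_sub_mul hG hρ.ne').ofReal (𝕜 := ℂ)).const_mul (ρ : ℂ)).bdd_mul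
      (c := 1) (by fun_prop)
      (ae_of_all _ fun p => (norm_cexp_ofReal_mul_ofReal_mul_I ξ p.1).le)

theorem charFun_withDensity_ofReal {p : ℝ → ℝ} (hp : Measurable p) (hnonneg : ∀ x, 0 ≤ p x)
    (ξ : ℝ) :
    charFun (volume.withDensity fun x => ENNReal.ofReal (p x)) ξ =
      ∫ x : ℝ, Complex.exp (ξ * x * I) * p x := by
  rw [charFun_apply_real, integral_withDensity_eq_integral_toReal_smul (by fun_prop)
    (ae_of_all _ fun _ => ENNReal.ofReal_lt_top)]
  refine integral_congr_ae (ae_of_all _ fun x => ?_)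
  simp only [ENNReal.toReal_ofReal (hnonneg x), Complex.real_smul, mul_comm]

end ScaledConv

/-! ### Compound kernels as integrals against the convolution exponential -/

section Compound

variable {σ h ζ : ℝ → ℝ} {Q : ℝ → Measure ℝ} {t M : ℝ}

theorem hasSum_compoundTerm [IsFiniteMeasure (Q t)] (hh : Measurable h) (hM : ∀ x, |h x| ≤ M)
    (x : ℝ) : HasSum (compoundTerm σ h ζ Q t x) (σ t * scaledConv h (ζ t) (convExp (Q t)) x) := by
  have hsum := hasSum_integral_convExp
    ((integrable_comp_sub_mul (E := convExp (Q t)) hh hM (ζ t) x).const_mul (σ t))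
  rwa [integral_const_mul] at hsum

theorem compoundKernelConverges [IsFiniteMeasure (Q t)] (hh : Measurable h)
    (hM : ∀ x, |h x| ≤ M) (x : ℝ) : CompoundKernelConverges σ h ζ Q t x :=
  ⟨inferInstance, fun _ => (integrable_comp_sub_mul hh hM (ζ t) x).const_mul (σ t),
    (hasSum_compoundTerm hh hM x).summable⟩

theorem measurable_fLower (b₃ b₄ : ℝ) : Measurable (fLower b₃ b₄) :=
  (Measurable.ite (measurableSet_le (by fun_prop) measurable_const) measurable_const
    measurable_const).const_mul b₃

theorem abs_fLower_le {b₃ : ℝ} (h : 0 ≤ b₃) (b₄ x : ℝ) : |fLower b₃ b₄ x| ≤ b₃ := by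
  rw [fLower]
  split_ifs <;> simp [abs_of_nonneg h, h]

theorem abs_fUpperSym_le {b₁ b₂ : ℝ} (h₁ : 0 ≤ b₁) (h₂ : 0 ≤ b₂) (x : ℝ) :
    |fUpperSym b₁ b₂ x| ≤ b₁ := by
  rw [abs_of_nonneg (fUpperSym_nonneg h₁ b₂ x)]
  exact fUpperSym_le h₁ h₂ x

end Compound

/-! ### Lévy measures satisfying condition **A** -/

section LevyMeasure

variable {μ : Measure ℝ} {β : ℝ}

theorem IsLevyMeasure.integrable_min_sq_one (hμ : IsLevyMeasure μ) (ξ : ℝ) :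
    Integrable (fun u : ℝ => min ((ξ * u) ^ 2) 1) μ := by
  have h1 : Integrable (fun u : ℝ => min 1 (u ^ 2)) μ := by
    refine ⟨by fun_prop, ?_⟩
    rw [hasFiniteIntegral_iff_ofReal (ae_of_all _ fun u => by positivity)]
    exact hμ.2
  refine (h1.const_mul (1 + ξ ^ 2)).mono' (by fun_prop) (ae_of_all _ fun u => ?_)
  rw [Real.norm_of_nonneg (by positivity)]
  rcases le_total 1 (u ^ 2) with h | h
  · rw [min_eq_left h]
    exact (min_le_right _ _).trans (by nlinarith [sq_nonneg ξ])
  · rw [min_eq_right h]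
    exact (min_le_left _ _).trans (by nlinarith [sq_nonneg u])

theorem IsLevyMeasure.integrable_psiL (hμ : IsLevyMeasure μ) (ξ : ℝ) :
    Integrable (fun u : ℝ => if |ξ * u| < 1 then (ξ * u) ^ 2 else 0) μ := by
  have hmeas : Measurable fun u : ℝ => if |ξ * u| < 1 then (ξ * u) ^ 2 else 0 :=
    Measurable.ite (measurableSet_lt (by fun_prop) measurable_const) (by fun_prop) measurable_const
  refine (hμ.integrable_min_sq_one ξ).mono' hmeas.aestronglyMeasurable (ae_of_all _ fun u => ?_)
  split_ifs with h
  · rw [Real.norm_of_nonneg (by positivity), min_eq_left ((sq_lt_one_iff_abs_lt_one _).2 h).le]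
  · rw [norm_zero]; positivity

theorem one_sub_cos_le_min (x : ℝ) : 1 - Real.cos x ≤ 2 * min (x ^ 2) 1 := by
  rcases le_total (x ^ 2) 1 with h | h
  · rw [min_eq_left h]; linarith [Real.one_sub_sq_div_two_le_cos (x := x), sq_nonneg x]
  · rw [min_eq_right h]; linarith [Real.neg_one_le_cos x]

theorem sq_le_one_sub_cos {x : ℝ} (hx : |x| ≤ 1) : x ^ 2 ≤ 3 * (1 - Real.cos x) := by
  have hcos := (abs_le.1 (Real.cos_bound hx)).2
  have hpow : |x| ^ 4 ≤ x ^ 2 := by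
    rw [← sq_abs x]
    exact pow_le_pow_of_le_one (abs_nonneg x) hx (by norm_num)
  linarith [sq_nonneg x]

theorem IsLevyMeasure.integrable_one_sub_cos (hμ : IsLevyMeasure μ) (ξ : ℝ) :
    Integrable (fun u : ℝ => 1 - Real.cos (ξ * u)) μ := by
  refine ((hμ.integrable_min_sq_one ξ).const_mul 2).mono' (by fun_prop) (ae_of_all _ fun u => ?_)
  rw [Real.norm_of_nonneg (one_sub_cos_nonneg _)]
  exact one_sub_cos_le_min _

theorem IsLevyMeasure.continuous_cosExp (hμ : IsLevyMeasure μ) : Continuous (cosExp μ) := by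
  refine continuous_iff_continuousAt.2 fun ξ₀ => ?_
  refine continuousAt_of_dominated (bound := fun u => 2 * min (((|ξ₀| + 1) * u) ^ 2) 1)
    (.of_forall fun ξ => by fun_prop) ?_ ((hμ.integrable_min_sq_one _).const_mul 2)
    (ae_of_all _ fun u => by fun_prop)
  filter_upwards [Metric.ball_mem_nhds ξ₀ one_pos] with ξ hξ
  refine ae_of_all _ fun u => ?_
  have hξ' : |ξ| ≤ |(|ξ₀| + 1)| := by
    rw [abs_of_nonneg (by positivity : 0 ≤ |ξ₀| + 1)]
    linarith [norm_le_norm_add_norm_sub' ξ ξ₀, mem_ball_iff_norm.1 hξ,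
      Real.norm_eq_abs ξ, Real.norm_eq_abs ξ₀]
  have hsq : (ξ * u) ^ 2 ≤ ((|ξ₀| + 1) * u) ^ 2 := by
    rw [mul_pow, mul_pow]
    exact mul_le_mul_of_nonneg_right (sq_le_sq.2 hξ') (sq_nonneg u)
  rw [Real.norm_of_nonneg (one_sub_cos_nonneg _)]
  exact (one_sub_cos_le_min _).trans (by gcongr)

theorem IsLevyMeasure.psiL_le_cosExp (hμ : IsLevyMeasure μ) (ξ : ℝ) :
    psiL μ ξ ≤ 3 * cosExp μ ξ := by
  rw [cosExp, ← integral_const_mul]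
  refine integral_mono (hμ.integrable_psiL ξ) ((hμ.integrable_one_sub_cos ξ).const_mul 3)
    fun u => ?_
  simp only
  split_ifs with h
  · exact sq_le_one_sub_cos h.le
  · linarith [one_sub_cos_nonneg (ξ * u)]

theorem IsLevyMeasure.psiU_le_cosExp (hμ : IsLevyMeasure μ) (hβ : 0 ≤ β)
    (hA : ∀ ξ, psiU μ ξ ≤ β * psiL μ ξ) (ξ : ℝ) : psiU μ ξ ≤ 3 * β * cosExp μ ξ :=
  calc psiU μ ξ ≤ β * psiL μ ξ := hA ξ
    _ ≤ β * (3 * cosExp μ ξ) := by gcongr; exact hμ.psiL_le_cosExp ξ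
    _ = 3 * β * cosExp μ ξ := by ring

theorem psiU_nonneg (μ : Measure ℝ) (ξ : ℝ) : 0 ≤ psiU μ ξ :=
  integral_nonneg fun u => by positivity

theorem IsLevyMeasure.psiU_mono (hμ : IsLevyMeasure μ) {ξ η : ℝ} (h : |ξ| ≤ |η|) :
    psiU μ ξ ≤ psiU μ η := by
  refine integral_mono (hμ.integrable_min_sq_one ξ) (hμ.integrable_min_sq_one η) fun u =>
    min_le_min_right _ ?_
  rw [mul_pow, mul_pow]
  exact mul_le_mul_of_nonneg_right (sq_le_sq.2 h) (sq_nonneg u)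

theorem IsLevyMeasure.psiU_one_pos (hμ : IsLevyMeasure μ) (hμ0 : μ ≠ 0) : 0 < psiU μ 1 := by
  refine (psiU_nonneg μ 1).lt_of_ne' fun h0 => hμ0 ?_
  have hzero := (integral_eq_zero_iff_of_nonneg (fun u => by positivity)
    (hμ.integrable_min_sq_one 1)).1 h0
  have hne : ∀ᵐ u ∂μ, u ≠ 0 := by
    rw [ae_iff]
    simpa using hμ.1
  refine ae_eq_bot.1 (eventually_false_iff_eq_bot.1 ?_)
  filter_upwards [hzero, hne] with u hu hu0
  have hpos : 0 < min ((1 * u) ^ 2) 1 := by positivity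
  exact hpos.ne' hu

theorem IsLevyMeasure.psiL_two_mul_le (hμ : IsLevyMeasure μ) (ξ : ℝ) :
    3 / 4 * psiL μ (2 * ξ) ≤ psiU μ (2 * ξ) - psiU μ ξ := by
  rw [psiL, psiU, psiU, ← integral_sub (hμ.integrable_min_sq_one _) (hμ.integrable_min_sq_one _),
    ← integral_const_mul]
  refine integral_mono ((hμ.integrable_psiL _).const_mul _)
    ((hμ.integrable_min_sq_one _).sub (hμ.integrable_min_sq_one _)) fun u => ?_
  have hsq : (2 * ξ * u) ^ 2 = 4 * (ξ * u) ^ 2 := by ring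
  have hpos := sq_nonneg (ξ * u)
  simp only
  split_ifs with h
  · have h1 := (sq_lt_one_iff_abs_lt_one _).2 h
    rw [min_eq_left h1.le, min_eq_left (by linarith), hsq]
    linarith
  · rw [mul_zero, sub_nonneg]
    exact min_le_min_right _ (by linarith)

theorem IsLevyMeasure.mul_psiU_le_psiU_two_mul (hμ : IsLevyMeasure μ) (hβ : 0 < β)
    (hA : ∀ ξ, psiU μ ξ ≤ β * psiL μ ξ) (ξ : ℝ) :
    (1 + 3 / (4 * β)) * psiU μ ξ ≤ psiU μ (2 * ξ) := by
  have hmono : psiU μ ξ ≤ psiU μ (2 * ξ) := hμ.psiU_mono (by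
    rw [abs_mul, abs_two]; linarith [abs_nonneg ξ])
  have hgain : 3 / (4 * β) * psiU μ ξ ≤ psiU μ (2 * ξ) - psiU μ ξ :=
    calc 3 / (4 * β) * psiU μ ξ ≤ 3 / (4 * β) * psiU μ (2 * ξ) := by gcongr
      _ ≤ 3 / (4 * β) * (β * psiL μ (2 * ξ)) := by gcongr; exact hA (2 * ξ)
      _ = 3 / 4 * psiL μ (2 * ξ) := by field_simp
      _ ≤ psiU μ (2 * ξ) - psiU μ ξ := hμ.psiL_two_mul_le ξ
  linarith

theorem IsLevyMeasure.pow_mul_psiU_le (hμ : IsLevyMeasure μ) (hβ : 0 < β)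
    (hA : ∀ ξ, psiU μ ξ ≤ β * psiL μ ξ) (ξ : ℝ) (n : ℕ) :
    (1 + 3 / (4 * β)) ^ n * psiU μ ξ ≤ psiU μ (2 ^ n * ξ) := by
  induction n with
  | zero => simp
  | succ n ih =>
    calc (1 + 3 / (4 * β)) ^ (n + 1) * psiU μ ξ
        = (1 + 3 / (4 * β)) * ((1 + 3 / (4 * β)) ^ n * psiU μ ξ) := by ring
      _ ≤ (1 + 3 / (4 * β)) * psiU μ (2 ^ n * ξ) := by gcongr
      _ ≤ psiU μ (2 * (2 ^ n * ξ)) := hμ.mul_psiU_le_psiU_two_mul hβ hA _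
      _ = psiU μ (2 ^ (n + 1) * ξ) := by rw [← mul_assoc, ← pow_succ']

/-- The exponent of the power growth that condition **A** with constant `β` forces on `psiU`:
doubling the argument multiplies `psiU` by at least `1 + 3 / (4 * β)`. -/
noncomputable def growthExponent (β : ℝ) : ℝ := Real.logb 2 (1 + 3 / (4 * β))

theorem growthExponent_pos (hβ : 0 < β) : 0 < growthExponent β :=
  Real.logb_pos one_lt_two (lt_add_of_pos_right 1 (by positivity))

theorem two_rpow_growthExponent (hβ : 0 < β) :
    (2 : ℝ) ^ growthExponent β = 1 + 3 / (4 * β) :=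
  Real.rpow_logb two_pos (by norm_num) (by positivity)

theorem IsLevyMeasure.rpow_mul_psiU_le (hμ : IsLevyMeasure μ) (hβ : 0 < β)
    (hA : ∀ ξ, psiU μ ξ ≤ β * psiL μ ξ) (ξ : ℝ) {s : ℝ} (hs : 1 ≤ s) :
    (s / 2) ^ growthExponent β * psiU μ ξ ≤ psiU μ (s * ξ) := by
  obtain ⟨n, hn, hn'⟩ := exists_nat_pow_near hs one_lt_two
  have hU := psiU_nonneg μ ξ
  have hα := growthExponent_pos hβ
  calc (s / 2) ^ growthExponent β * psiU μ ξ
      ≤ ((2 : ℝ) ^ n) ^ growthExponent β * psiU μ ξ := by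
        gcongr
        rw [pow_succ] at hn'
        linarith
    _ = (1 + 3 / (4 * β)) ^ n * psiU μ ξ := by
        rw [← Real.rpow_pow_comm zero_le_two, two_rpow_growthExponent hβ]
    _ ≤ psiU μ (2 ^ n * ξ) := hμ.pow_mul_psiU_le hβ hA ξ n
    _ ≤ psiU μ (s * ξ) := hμ.psiU_mono (by
        rw [abs_mul, abs_mul, abs_of_pos (by positivity : (0 : ℝ) < 2 ^ n),
          abs_of_nonneg (zero_le_one.trans hs)]
        gcongr)

theorem IsLevyMeasure.tendsto_psiU_atTop (hμ : IsLevyMeasure μ) (hμ0 : μ ≠ 0) (hβ : 0 < β)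
    (hA : ∀ ξ, psiU μ ξ ≤ β * psiL μ ξ) : Tendsto (psiU μ) atTop atTop := by
  have hpow : Tendsto (fun s : ℝ => (s / 2) ^ growthExponent β * psiU μ 1) atTop atTop :=
    ((tendsto_rpow_atTop (growthExponent_pos hβ)).comp
      (tendsto_id.atTop_div_const two_pos)).atTop_mul_const (hμ.psiU_one_pos hμ0)
  refine tendsto_atTop_mono' _ ?_ hpow
  filter_upwards [eventually_ge_atTop 1] with s hs
  simpa using hμ.rpow_mul_psiU_le hβ hA 1 hs

theorem exists_one_add_pow_mul_exp_neg_rpow_le {α c : ℝ} (hα : 0 < α) (hc : 0 < c) (k : ℕ) :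
    ∃ D : ℝ, ∀ x : ℝ, 0 ≤ x → (1 + x) ^ k * Real.exp (-(c * x ^ α)) ≤ D := by
  obtain ⟨m, hm⟩ := exists_nat_ge (k / α)
  rw [div_le_iff₀ hα] at hm
  refine ⟨2 ^ k * (1 + m.factorial / c ^ m), fun x hx => ?_⟩
  rw [Real.exp_neg, ← div_eq_mul_inv, div_le_iff₀ (Real.exp_pos _)]
  have hexp : 1 ≤ Real.exp (c * x ^ α) := Real.one_le_exp (by positivity)
  have hxk : max 1 x ^ k ≤ (1 + m.factorial / c ^ m) * Real.exp (c * x ^ α) := by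
    have hfac : 0 ≤ m.factorial / c ^ m * Real.exp (c * x ^ α) := by positivity
    rcases le_total x 1 with h | h
    · rw [max_eq_left h, one_pow]
      linarith
    · have hpow := Real.pow_div_factorial_le_exp (c * x ^ α) (by positivity) m
      rw [div_le_iff₀ (by positivity), mul_pow, ← le_div_iff₀' (by positivity)] at hpow
      calc max 1 x ^ k = x ^ (k : ℝ) := by rw [max_eq_right h, Real.rpow_natCast]
        _ ≤ x ^ (α * m) := Real.rpow_le_rpow_of_exponent_le h (by linarith)
        _ = (x ^ α) ^ m := Real.rpow_mul_natCast hx α m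
        _ ≤ Real.exp (c * x ^ α) * m.factorial / c ^ m := hpow
        _ ≤ _ := by rw [mul_div_assoc, mul_comm]; linarith
  calc (1 + x) ^ k ≤ (2 * max 1 x) ^ k := by
        gcongr
        linarith [le_max_left 1 x, le_max_right 1 x]
    _ = 2 ^ k * max 1 x ^ k := mul_pow _ _ _
    _ ≤ 2 ^ k * ((1 + m.factorial / c ^ m) * Real.exp (c * x ^ α)) := by gcongr
    _ = _ := by ring

end LevyMeasure

/-! ### Symmetry of the Lévy measure -/

section Symmetry

variable {μ : Measure ℝ}

theorem norm_one_sub_exp_add_le (ξ u : ℝ) :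
    ‖1 - Complex.exp (I * ξ * u) + (if |u| < 1 then I * ξ * u else 0)‖ ≤
      (2 + ξ ^ 2 * Real.exp |ξ|) * min ((1 * u) ^ 2) 1 := by
  have hpos : 0 ≤ ξ ^ 2 * Real.exp |ξ| := by positivity
  rw [one_mul]
  split_ifs with hu
  · have htaylor : ‖1 - Complex.exp (I * ξ * u) + I * ξ * u‖ ≤
        ‖I * ξ * u‖ ^ 2 * Real.exp ‖I * ξ * u‖ := by
      have hsum : 1 - Complex.exp (I * ξ * u) + I * ξ * u = -(Complex.exp (I * ξ * u) -
          ∑ m ∈ Finset.range 2, (I * ξ * u) ^ m / (m.factorial : ℂ)) := by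
        simp [Finset.sum_range_succ]
        ring
      rw [hsum, norm_neg]
      exact Complex.norm_exp_sub_sum_le_norm_mul_exp _ 2
    rw [min_eq_left ((sq_lt_one_iff_abs_lt_one u).2 hu).le]
    calc ‖1 - Complex.exp (I * ξ * u) + I * ξ * u‖
        ≤ (|ξ| * |u|) ^ 2 * Real.exp (|ξ| * |u|) := by
          simpa only [norm_mul, Complex.norm_I, one_mul, Complex.norm_real, Real.norm_eq_abs]
            using htaylor
      _ ≤ (|ξ| * |u|) ^ 2 * Real.exp |ξ| := by
          gcongr
          exact mul_le_of_le_one_right (abs_nonneg _) hu.le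
      _ = ξ ^ 2 * Real.exp |ξ| * u ^ 2 := by rw [mul_pow, sq_abs, sq_abs]; ring
      _ ≤ (2 + ξ ^ 2 * Real.exp |ξ|) * u ^ 2 := by gcongr; linarith
  · have hexp : ‖Complex.exp (I * ξ * u)‖ = 1 := by
      rw [mul_assoc, mul_comm]
      exact norm_cexp_ofReal_mul_ofReal_mul_I ξ u
    have hnorm := norm_sub_le (1 : ℂ) (Complex.exp (I * ξ * u))
    rw [hexp, norm_one] at hnorm
    rw [min_eq_right ((one_le_sq_iff_one_le_abs u).2 (not_lt.1 hu)), add_zero]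
    linarith

theorem IsLevyMeasure.integrable_charExponent (hμ : IsLevyMeasure μ) (ξ : ℝ) :
    Integrable (fun u : ℝ => 1 - Complex.exp (I * ξ * u) +
      (if |u| < 1 then I * ξ * u else 0)) μ := by
  have hmeas : Measurable fun u : ℝ => 1 - Complex.exp (I * ξ * u) +
      (if |u| < 1 then I * ξ * u else 0) :=
    Measurable.add (by fun_prop) (Measurable.ite
      (measurableSet_lt (by fun_prop) measurable_const) (by fun_prop) measurable_const)
  exact ((hμ.integrable_min_sq_one 1).const_mul _).mono' hmeas.aestronglyMeasurable
    (ae_of_all _ (norm_one_sub_exp_add_le ξ))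

theorem one_sub_exp_add_eq (ξ u : ℝ) :
    1 - Complex.exp (I * ξ * u) + (if |u| < 1 then I * ξ * u else 0) =
      ((1 - Real.cos (ξ * u) : ℝ) : ℂ) +
        (((if |u| < 1 then ξ * u else 0) - Real.sin (ξ * u) : ℝ) : ℂ) * I := by
  have hexp : Complex.exp (I * ξ * u) =
      (Real.cos (ξ * u) : ℂ) + (Real.sin (ξ * u) : ℂ) * I := by
    rw [Complex.ofReal_cos, Complex.ofReal_sin, ← Complex.exp_mul_I]
    push_cast
    ring_nf
  rw [hexp]
  split_ifs <;> push_cast <;> ring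

theorem IsLevyMeasure.re_charExponent (hμ : IsLevyMeasure μ) (a ξ : ℝ) :
    (charExponent a μ ξ).re = cosExp μ ξ := by
  have hdrift : (I * a * ξ).re = 0 := by simp
  rw [charExponent, Complex.add_re, hdrift, zero_add]
  refine (integral_re (𝕜 := ℂ) (hμ.integrable_charExponent ξ)).symm.trans ?_
  refine integral_congr_ae (ae_of_all _ fun u => ?_)
  simp only [one_sub_exp_add_eq, RCLike.re_to_complex, Complex.add_re, Complex.ofReal_re,
    Complex.re_ofReal_mul, Complex.I_re, mul_zero, add_zero]

theorem IsLevyMeasure.im_charExponent (hμ : IsLevyMeasure μ) (a ξ : ℝ) :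
    (charExponent a μ ξ).im =
      a * ξ + ∫ u : ℝ, ((if |u| < 1 then ξ * u else 0) - Real.sin (ξ * u)) ∂μ := by
  have hdrift : (I * a * ξ).im = a * ξ := by simp
  rw [charExponent, Complex.add_im, hdrift]
  congr 1
  refine (integral_im (𝕜 := ℂ) (hμ.integrable_charExponent ξ)).symm.trans ?_
  refine integral_congr_ae (ae_of_all _ fun u => ?_)
  simp only [one_sub_exp_add_eq, RCLike.im_to_complex, Complex.add_im, Complex.ofReal_im,
    Complex.im_ofReal_mul, Complex.I_im, mul_one, zero_add]

theorem IsLevyMeasure.integrable_im_charExponent (hμ : IsLevyMeasure μ) (ξ : ℝ) :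
    Integrable (fun u : ℝ => (if |u| < 1 then ξ * u else 0) - Real.sin (ξ * u)) μ := by
  refine (hμ.integrable_charExponent ξ).im.congr (ae_of_all _ fun u => ?_)
  simp only [one_sub_exp_add_eq, RCLike.im_to_complex, Complex.add_im, Complex.ofReal_im,
    Complex.im_ofReal_mul, Complex.I_im, mul_one, zero_add]

-- Taking second differences in `ξ` removes both the drift and the compensator.
theorem IsLevyMeasure.integral_sin_mul_one_sub_cos (hμ : IsLevyMeasure μ) (a ξ h : ℝ) :
    2 * ∫ u : ℝ, Real.sin (ξ * u) * (1 - Real.cos (h * u)) ∂μ =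
      (charExponent a μ (ξ + h)).im + (charExponent a μ (ξ - h)).im -
        2 * (charExponent a μ ξ).im := by
  have hint := hμ.integrable_im_charExponent
  have hsin : ∀ u : ℝ, 2 * (Real.sin (ξ * u) * (1 - Real.cos (h * u))) =
      ((if |u| < 1 then (ξ + h) * u else 0) - Real.sin ((ξ + h) * u)) +
      ((if |u| < 1 then (ξ - h) * u else 0) - Real.sin ((ξ - h) * u)) -
      2 * ((if |u| < 1 then ξ * u else 0) - Real.sin (ξ * u)) := fun u => by
    rw [add_mul, sub_mul, Real.sin_add, Real.sin_sub]
    split_ifs <;> ring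
  rw [← integral_const_mul]
  simp_rw [hsin]
  rw [integral_sub (by exact (hint _).add (hint _)) ((hint ξ).const_mul 2),
    integral_add (hint _) (hint _), integral_const_mul]
  simp only [hμ.im_charExponent]
  ring

/-- A positive weight on `ℝ \ {0}` that makes every Lévy measure finite. Since `√2` is irrational,
its two summands have no common zero besides `0`. -/
noncomputable def symWeight (u : ℝ) : ℝ := (1 - Real.cos (1 * u)) + (1 - Real.cos (√2 * u))

theorem measurable_symWeight : Measurable symWeight := by
  unfold symWeight
  fun_prop

theorem symWeight_neg (u : ℝ) : symWeight (-u) = symWeight u := by simp [symWeight]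

theorem symWeight_pos {u : ℝ} (hu : u ≠ 0) : 0 < symWeight u := by
  have h1 := one_sub_cos_nonneg (1 * u)
  have h2 := one_sub_cos_nonneg (√2 * u)
  refine (add_nonneg h1 h2).lt_of_ne' fun hzero => ?_
  obtain ⟨m, hm⟩ := (Real.cos_eq_one_iff _).1 (by linarith : Real.cos (1 * u) = 1)
  obtain ⟨n, hn⟩ := (Real.cos_eq_one_iff _).1 (by linarith : Real.cos (√2 * u) = 1)
  rw [one_mul] at hm
  have hm0 : (m : ℝ) ≠ 0 := fun h0 => hu (by rw [← hm, h0, zero_mul])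
  refine irrational_sqrt_two ⟨n / m, ?_⟩
  push_cast
  rw [div_eq_iff hm0]
  refine mul_right_cancel₀ Real.two_pi_pos.ne' ?_
  rw [hn, mul_assoc, hm]

theorem symWeight_nonneg (u : ℝ) : 0 ≤ symWeight u :=
  add_nonneg (one_sub_cos_nonneg _) (one_sub_cos_nonneg _)

theorem IsLevyMeasure.integrable_symWeight (hμ : IsLevyMeasure μ) : Integrable symWeight μ :=
  (hμ.integrable_one_sub_cos 1).add (hμ.integrable_one_sub_cos √2)

theorem isNegInvariant_of_im_charFun_eq_zero (Q : Measure ℝ) [IsFiniteMeasure Q]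
    (h : ∀ ξ, (charFun Q ξ).im = 0) : Q.IsNegInvariant := by
  refine ⟨(?_ : Q.map Neg.neg = Q)⟩
  refine Measure.ext_of_charFun (funext fun ξ => ?_)
  have hneg := charFun_map_mul (μ := Q) (-1) ξ
  simp only [neg_mul, one_mul] at hneg
  exact hneg.trans (by rw [charFun_neg, Complex.conj_eq_iff_im.2 (h ξ)])

theorem isNegInvariant_withDensity {ν : Measure ℝ} [ν.IsNegInvariant] {f : ℝ → ℝ≥0∞}
    (hf : Measurable f) (heven : ∀ u, f (-u) = f u) : (ν.withDensity f).IsNegInvariant := by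
  refine ⟨Measure.ext fun s hs => ?_⟩
  have h := (Measure.measurePreserving_neg ν).setLIntegral_comp_preimage hs hf
  simp only [heven] at h
  rw [Measure.neg, Measure.map_apply measurable_neg hs, withDensity_apply _ (measurable_neg hs),
    withDensity_apply _ hs, ← h]

theorem IsLevyMeasure.isNegInvariant_withDensity_symWeight (hμ : IsLevyMeasure μ) {a : ℝ}
    (him : ∀ ξ, (charExponent a μ ξ).im = 0) :
    (μ.withDensity fun u => ENNReal.ofReal (symWeight u)).IsNegInvariant := by
  set ν := μ.withDensity fun u => ENNReal.ofReal (symWeight u) with hν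
  have hfin : IsFiniteMeasure ν := isFiniteMeasure_withDensity_ofReal hμ.integrable_symWeight.2
  have hsin : ∀ ξ h : ℝ, ∫ u : ℝ, Real.sin (ξ * u) * (1 - Real.cos (h * u)) ∂μ = 0 := fun ξ h => by
    have hdiff := hμ.integral_sin_mul_one_sub_cos a ξ h
    rw [him, him, him] at hdiff
    linarith
  have hint : ∀ ξ h : ℝ, Integrable (fun u : ℝ => Real.sin (ξ * u) * (1 - Real.cos (h * u))) μ :=
    fun ξ h => (hμ.integrable_one_sub_cos h).bdd_mul (c := 1) (by fun_prop)
      (ae_of_all _ fun u => Real.abs_sin_le_one _)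
  refine isNegInvariant_of_im_charFun_eq_zero ν fun ξ => ?_
  calc (charFun ν ξ).im = ∫ u : ℝ, Real.sin (ξ * u) ∂ν := by
        rw [charFun_apply_real]
        refine (integral_im (𝕜 := ℂ) (integrable_cexp_mul_I ν ξ)).symm.trans ?_
        refine integral_congr_ae (ae_of_all _ fun u => ?_)
        change (Complex.exp (ξ * u * I)).im = _
        rw [← Complex.ofReal_mul, Complex.exp_ofReal_mul_I_im]
    _ = ∫ u : ℝ, Real.sin (ξ * u) * symWeight u ∂μ := by
        rw [hν, integral_withDensity_eq_integral_toReal_smul measurable_symWeight.ennreal_ofReal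
          (ae_of_all _ fun _ => ENNReal.ofReal_lt_top)]
        congr 1 with u
        rw [ENNReal.toReal_ofReal (symWeight_nonneg u), smul_eq_mul, mul_comm]
    _ = 0 := by
        simp only [symWeight, mul_add]
        rw [integral_add (hint ξ 1) (hint ξ √2), hsin, hsin, add_zero]

theorem IsLevyMeasure.isNegInvariant (hμ : IsLevyMeasure μ) {a : ℝ}
    (him : ∀ ξ, (charExponent a μ ξ).im = 0) : μ.IsNegInvariant := by
  set w : ℝ → ℝ≥0∞ := fun u => ENNReal.ofReal (symWeight u) with hw
  have hmeas : Measurable w := measurable_symWeight.ennreal_ofReal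
  have hpos : ∀ᵐ u ∂μ, w u ≠ 0 := by
    have hne : ∀ᵐ u ∂μ, u ≠ 0 := by
      rw [ae_iff]
      simpa using hμ.1
    filter_upwards [hne] with u hu
    simpa [hw] using symWeight_pos hu
  have := hμ.isNegInvariant_withDensity_symWeight him
  rw [← withDensity_inv_same hmeas hpos (ae_of_all _ fun _ => ENNReal.ofReal_ne_top)]
  exact isNegInvariant_withDensity hmeas.inv fun u => by
    simp only [hw, symWeight_neg]

theorem IsLevyMeasure.charExponent_eq_cosExp (hμ : IsLevyMeasure μ) {a : ℝ}
    (him : ∀ ξ, (charExponent a μ ξ).im = 0) : charExponent a μ = fun ξ => (cosExp μ ξ : ℂ) :=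
  funext fun ξ => Complex.ext (by rw [hμ.re_charExponent, Complex.ofReal_re]) (him ξ)

theorem eq_zero_of_forall_sin_mul_eq_zero {c : ℝ} (h : ∀ t : ℝ≥0, Real.sin (t * c) = 0) :
    c = 0 := by
  by_contra hc
  have habs : ∀ t : ℝ≥0, Real.sin (t * |c|) = 0 := fun t => by
    rcases abs_choice c with hc' | hc' <;> simp [hc', h t]
  have hpi : Real.sin (π / 2 / |c| * |c|) = 0 := habs ⟨π / 2 / |c|, by positivity⟩
  rw [div_mul_cancel₀ _ (abs_ne_zero.2 hc), Real.sin_pi_div_two] at hpi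
  exact one_ne_zero hpi

variable {Ω : Type*} [MeasurableSpace Ω] {P : Measure Ω} {Z : ℝ≥0 → Ω → ℝ} {ψ : ℝ → ℂ}

theorem HasCharExponent.aemeasurable (hψ : HasCharExponent Z P ψ) (t : ℝ≥0) :
    AEMeasurable (Z t) P := by
  refine AEMeasurable.of_map_ne_zero fun h0 => Complex.exp_ne_zero _ ((hψ t 0).symm.trans ?_)
  simp [h0]

theorem HasCharExponent.im_eq_zero [IsFiniteMeasure P] (hψ : HasCharExponent Z P ψ)
    (hs : IsSymmetricProcess Z P) (ξ : ℝ) : (ψ ξ).im = 0 := by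
  refine eq_zero_of_forall_sin_mul_eq_zero fun t => ?_
  have hneg : (P.map (Z t)).IsNegInvariant := ⟨by
    rw [Measure.neg, AEMeasurable.map_map_of_aemeasurable (by fun_prop) (hψ.aemeasurable t)]
    exact hs t⟩
  have him : (Complex.exp (-((t : ℝ) : ℂ) * ψ ξ)).im = 0 := by
    rw [← hψ t ξ, charFun_of_isNegInvariant, Complex.ofReal_im]
  rw [Complex.exp_im, ← Complex.ofReal_neg, Complex.im_ofReal_mul, neg_mul, Real.sin_neg, mul_neg,
    neg_eq_zero] at him
  exact (mul_eq_zero.1 him).resolve_left (Real.exp_pos _).ne'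

end Symmetry

/-! ### Small and large jumps at the scale `rho` -/

section Scale

variable {μ : Measure ℝ} {β : ℝ}

@[simp]
theorem cosExp_zero (μ : Measure ℝ) : cosExp μ 0 = 0 := by simp [cosExp]

theorem IsLevyMeasure.cosExp_le_psiU (hμ : IsLevyMeasure μ) (ξ : ℝ) :
    cosExp μ ξ ≤ 2 * psiU μ ξ := by
  rw [cosExp, psiU, ← integral_const_mul]
  exact integral_mono (hμ.integrable_one_sub_cos ξ) ((hμ.integrable_min_sq_one ξ).const_mul 2)
    fun u => one_sub_cos_le_min (ξ * u)

theorem IsLevyMeasure.exists_le_cosExp (hμ : IsLevyMeasure μ) (hμ0 : μ ≠ 0) (hβ : 0 < β)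
    (hA : ∀ ξ, psiU μ ξ ≤ β * psiL μ ξ) (c : ℝ) : ∃ ξ, 0 ≤ ξ ∧ c ≤ cosExp μ ξ := by
  obtain ⟨ξ, hξ, hc⟩ := ((eventually_ge_atTop (0 : ℝ)).and
    ((hμ.tendsto_psiU_atTop hμ0 hβ hA).eventually_ge_atTop (3 * β * c))).exists
  exact ⟨ξ, hξ, le_of_mul_le_mul_left (hc.trans (hμ.psiU_le_cosExp hβ.le hA ξ)) (by positivity)⟩

theorem IsLevyMeasure.setOf_le_re_charExponent (hμ : IsLevyMeasure μ) (a : ℝ) {c : ℝ}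
    (hc : 0 < c) :
    {ξ : ℝ | 0 < ξ ∧ c ≤ (charExponent a μ ξ).re} = Set.Ici 0 ∩ {ξ | c ≤ cosExp μ ξ} := by
  ext ξ
  simp only [Set.mem_ofPred_eq, Set.mem_inter_iff, Set.mem_Ici, hμ.re_charExponent]
  refine and_congr_left fun h => ⟨le_of_lt, fun h0 => h0.lt_of_ne' ?_⟩
  rintro rfl
  rw [cosExp_zero] at h
  exact hc.not_ge h

theorem IsLevyMeasure.isLeast_rho (hμ : IsLevyMeasure μ) (hμ0 : μ ≠ 0) (hβ : 0 < β)
    (hA : ∀ ξ, psiU μ ξ ≤ β * psiL μ ξ) (a : ℝ) {t : ℝ} (ht : 0 < t) :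
    IsLeast (Set.Ici 0 ∩ {ξ | 1 / t ≤ cosExp μ ξ}) (rho (charExponent a μ) t) := by
  rw [rho, hμ.setOf_le_re_charExponent a (one_div_pos.2 ht)]
  have hclosed : IsClosed (Set.Ici 0 ∩ {ξ | 1 / t ≤ cosExp μ ξ}) :=
    isClosed_Ici.inter (isClosed_le continuous_const hμ.continuous_cosExp)
  exact hclosed.isLeast_csInf (hμ.exists_le_cosExp hμ0 hβ hA _) (bddBelow_Ici.mono
    Set.inter_subset_left)

theorem IsLevyMeasure.mul_cosExp_rho (hμ : IsLevyMeasure μ) (hμ0 : μ ≠ 0) (hβ : 0 < β)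
    (hA : ∀ ξ, psiU μ ξ ≤ β * psiL μ ξ) (a : ℝ) {t : ℝ} (ht : 0 < t) :
    t * cosExp μ (rho (charExponent a μ) t) = 1 := by
  obtain ⟨⟨hρ, hge⟩, hmin⟩ := hμ.isLeast_rho hμ0 hβ hA a ht
  obtain ⟨ξ, hξ, hξt⟩ := intermediate_value_Icc hρ hμ.continuous_cosExp.continuousOn
    (show 1 / t ∈ Set.Icc (cosExp μ 0) _ from ⟨by rw [cosExp_zero]; positivity, hge⟩)
  rw [← hξ.2.antisymm (hmin ⟨hξ.1, hξt.ge⟩), hξt, mul_one_div_cancel ht.ne']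

theorem IsLevyMeasure.rho_pos (hμ : IsLevyMeasure μ) (hμ0 : μ ≠ 0) (hβ : 0 < β)
    (hA : ∀ ξ, psiU μ ξ ≤ β * psiL μ ξ) (a : ℝ) {t : ℝ} (ht : 0 < t) :
    0 < rho (charExponent a μ) t := by
  refine (hμ.isLeast_rho hμ0 hβ hA a ht).1.1.lt_of_ne' fun h0 => ?_
  simpa [h0] using hμ.mul_cosExp_rho hμ0 hβ hA a ht

end Scale

section Decomposition

variable {μ : Measure ℝ} {β ρ t : ℝ}

/-- The Lévy measure of the small jump part of `Z t`: the jumps of size at most `1 / ρ`, with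
intensity `t`, rescaled by `ρ` so that the result lives on `[-1, 1]`. -/
noncomputable def smallJumps (μ : Measure ℝ) (ρ t : ℝ) : Measure ℝ :=
  (ENNReal.ofReal t • μ.restrict {u : ℝ | |ρ * u| ≤ 1}).map (ρ * ·)

/-- The Lévy measure of the large jump part of `Z t`: the jumps of size larger than `1 / ρ`, with
intensity `t`. It is `Lam ψ μ t` when `ρ = rho ψ t`. -/
noncomputable def bigJumps (μ : Measure ℝ) (ρ t : ℝ) : Measure ℝ :=
  ENNReal.ofReal t • μ.restrict {u : ℝ | 1 < |ρ * u|}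

theorem measurableSet_abs_mul_le_one (ρ : ℝ) : MeasurableSet {u : ℝ | |ρ * u| ≤ 1} :=
  measurableSet_le (by fun_prop) measurable_const

instance isNegInvariant_smallJumps [μ.IsNegInvariant] : (smallJumps μ ρ t).IsNegInvariant := by
  have := isNegInvariant_restrict (ν := μ) (s := {u : ℝ | |ρ * u| ≤ 1}) (by ext; simp)
  have := isNegInvariant_smul (μ.restrict {u : ℝ | |ρ * u| ≤ 1}) (ENNReal.ofReal t)
  exact isNegInvariant_map_const_mul _ ρ

instance isNegInvariant_bigJumps [μ.IsNegInvariant] : (bigJumps μ ρ t).IsNegInvariant := by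
  have := isNegInvariant_restrict (ν := μ) (s := {u : ℝ | 1 < |ρ * u|}) (by ext; simp)
  exact isNegInvariant_smul _ (ENNReal.ofReal t)

theorem cosExp_smallJumps (ht : 0 ≤ t) (η : ℝ) :
    cosExp (smallJumps μ ρ t) η =
      t * ∫ u in {u : ℝ | |ρ * u| ≤ 1}, (1 - Real.cos (ρ * η * u)) ∂μ := by
  rw [cosExp, smallJumps, integral_map (by fun_prop) (by fun_prop), integral_smul_measure,
    ENNReal.toReal_ofReal ht, smul_eq_mul]
  simp only [mul_left_comm η ρ, mul_assoc]

theorem IsLevyMeasure.cosExp_smallJumps_add_cosExp_bigJumps (hμ : IsLevyMeasure μ) (ht : 0 ≤ t)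
    (η : ℝ) :
    cosExp (smallJumps μ ρ t) η + cosExp (bigJumps μ ρ t) (ρ * η) = t * cosExp μ (ρ * η) := by
  have hcompl : {u : ℝ | 1 < |ρ * u|} = {u : ℝ | |ρ * u| ≤ 1}ᶜ := by ext; simp
  rw [cosExp_smallJumps ht, cosExp, bigJumps, integral_smul_measure, ENNReal.toReal_ofReal ht,
    smul_eq_mul, ← mul_add, hcompl, integral_add_compl (measurableSet_abs_mul_le_one ρ)
    (hμ.integrable_one_sub_cos _), cosExp]

theorem min_sq_one_eq_one {x : ℝ} (hx : 1 < |x|) : min (x ^ 2) 1 = 1 :=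
  min_eq_right ((one_le_sq_iff_one_le_abs x).2 hx.le)

theorem IsLevyMeasure.isFiniteMeasure_bigJumps (hμ : IsLevyMeasure μ) (ρ t : ℝ) :
    IsFiniteMeasure (bigJumps μ ρ t) := by
  have hsub : {u : ℝ | 1 < |ρ * u|} ⊆ {u | 1 ≤ ‖min ((ρ * u) ^ 2) 1‖} := fun u hu =>
    show 1 ≤ ‖_‖ from (by rw [min_sq_one_eq_one hu, norm_one])
  have : IsFiniteMeasure (μ.restrict {u : ℝ | 1 < |ρ * u|}) :=
    isFiniteMeasure_restrict.2 ((measure_mono hsub).trans_lt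
      ((hμ.integrable_min_sq_one ρ).measure_norm_ge_lt_top one_pos)).ne
  exact Measure.smul_finite _ ENNReal.ofReal_ne_top

theorem IsLevyMeasure.bigJumps_real_univ_le (hμ : IsLevyMeasure μ) (ht : 0 ≤ t) :
    (bigJumps μ ρ t).real Set.univ ≤ t * psiU μ ρ := by
  have hmeas : MeasurableSet {u : ℝ | 1 < |ρ * u|} :=
    measurableSet_lt measurable_const (by fun_prop)
  rw [bigJumps, measureReal_ennreal_smul_apply, measureReal_restrict_apply_univ,
    ENNReal.toReal_ofReal ht, ← integral_indicator_one hmeas]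
  refine mul_le_mul_of_nonneg_left (integral_mono_of_nonneg
    (ae_of_all _ fun u => Set.indicator_nonneg (by simp) u) (hμ.integrable_min_sq_one ρ)
    (ae_of_all _ (Set.indicator_le' ?_ fun u _ => ?_))) ht
  · exact fun u hu => (min_sq_one_eq_one hu).ge
  · positivity

theorem cosExp_le_two_mul_real_univ (Q : Measure ℝ) [IsFiniteMeasure Q] (ξ : ℝ) :
    cosExp Q ξ ≤ 2 * Q.real Set.univ :=
  calc cosExp Q ξ ≤ ∫ _, 2 ∂Q :=
        integral_mono_of_nonneg (ae_of_all _ fun v => one_sub_cos_nonneg _) (integrable_const _)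
          (ae_of_all _ fun v => by simp only; linarith [Real.neg_one_le_cos (ξ * v)])
    _ = 2 * Q.real Set.univ := by rw [integral_const, smul_eq_mul, mul_comm]

theorem IsLevyMeasure.mul_psiU_le (hμ : IsLevyMeasure μ) (hβ : 0 ≤ β)
    (hA : ∀ ξ, psiU μ ξ ≤ β * psiL μ ξ) (ht : 0 ≤ t) (hρ : t * cosExp μ ρ = 1) :
    t * psiU μ ρ ≤ 3 * β :=
  calc t * psiU μ ρ ≤ t * (3 * β * cosExp μ ρ) := by gcongr; exact hμ.psiU_le_cosExp hβ hA ρ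
    _ = 3 * β := by rw [mul_left_comm, hρ, mul_one]

theorem IsLevyMeasure.rpow_sub_le_cosExp_smallJumps (hμ : IsLevyMeasure μ) (hβ : 0 < β)
    (hA : ∀ ξ, psiU μ ξ ≤ β * psiL μ ξ) (ht : 0 ≤ t) (hρ : t * cosExp μ ρ = 1) {η : ℝ}
    (hη : 1 ≤ |η|) :
    1 / (6 * β) * (|η| / 2) ^ growthExponent β - 6 * β ≤ cosExp (smallJumps μ ρ t) η := by
  have := hμ.isFiniteMeasure_bigJumps ρ t
  have hbig : cosExp (bigJumps μ ρ t) (ρ * η) ≤ 6 * β := by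
    linarith [cosExp_le_two_mul_real_univ (bigJumps μ ρ t) (ρ * η), hμ.mul_psiU_le hβ.le hA ht hρ,
      hμ.bigJumps_real_univ_le (ρ := ρ) ht]
  have hone : 1 ≤ 2 * (t * psiU μ ρ) :=
    calc 1 = t * cosExp μ ρ := hρ.symm
      _ ≤ t * (2 * psiU μ ρ) := by gcongr; exact hμ.cosExp_le_psiU ρ
      _ = 2 * (t * psiU μ ρ) := by ring
  have hgrowth : (|η| / 2) ^ growthExponent β * psiU μ ρ ≤ 3 * β * cosExp μ (ρ * η) :=
    calc _ ≤ psiU μ (|η| * ρ) := hμ.rpow_mul_psiU_le hβ hA ρ hη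
      _ ≤ psiU μ (ρ * η) := hμ.psiU_mono (by rw [abs_mul, abs_abs, abs_mul, mul_comm])
      _ ≤ 3 * β * cosExp μ (ρ * η) := hμ.psiU_le_cosExp hβ.le hA _
  have htotal : 1 / (6 * β) * (|η| / 2) ^ growthExponent β ≤ t * cosExp μ (ρ * η) := by
    rw [one_div_mul_eq_div, div_le_iff₀ (by positivity)]
    calc (|η| / 2) ^ growthExponent β
        ≤ (|η| / 2) ^ growthExponent β * (2 * (t * psiU μ ρ)) :=
          le_mul_of_one_le_right (by positivity) hone
      _ = 2 * t * ((|η| / 2) ^ growthExponent β * psiU μ ρ) := by ring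
      _ ≤ 2 * t * (3 * β * cosExp μ (ρ * η)) := by gcongr
      _ = t * cosExp μ (ρ * η) * (6 * β) := by ring
  linarith [hμ.cosExp_smallJumps_add_cosExp_bigJumps (ρ := ρ) ht η]

theorem exists_decay_of_rpow_sub_le {α c C : ℝ} (hα : 0 < α) (hc : 0 < c) :
    ∃ D : ℕ → ℝ, ∀ ν : Measure ℝ, (∀ η, 1 ≤ |η| → c * (|η| / 2) ^ α - C ≤ cosExp ν η) →
      ∀ k η, (1 + |η|) ^ k * Real.exp (-cosExp ν η) ≤ D k := by
  choose D hD using fun k => exists_one_add_pow_mul_exp_neg_rpow_le hα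
    (by positivity : 0 < c / 2 ^ α) k
  refine ⟨fun k => max (2 ^ k) (D k * Real.exp C), fun ν hν k η => ?_⟩
  rcases le_total |η| 1 with hη | hη
  · refine le_max_of_le_left ?_
    calc (1 + |η|) ^ k * Real.exp (-cosExp ν η) ≤ 2 ^ k * 1 := by
          gcongr
          · linarith
          · exact Real.exp_le_one_iff.2 (neg_nonpos.2 (cosExp_nonneg ν η))
      _ = 2 ^ k := mul_one _
  · refine le_max_of_le_right ?_
    calc (1 + |η|) ^ k * Real.exp (-cosExp ν η)
        ≤ (1 + |η|) ^ k * Real.exp (-(c * (|η| / 2) ^ α) + C) := by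
          gcongr
          linarith [hν η hη]
      _ = (1 + |η|) ^ k * Real.exp (-(c / 2 ^ α * |η| ^ α)) * Real.exp C := by
          rw [Real.exp_add, Real.div_rpow (abs_nonneg η) zero_le_two, mul_assoc]
          ring_nf
      _ ≤ D k * Real.exp C := by gcongr; exact hD k _ (abs_nonneg η)

theorem IsLevyMeasure.exists_isSmallJump_smallJumps (hμ : IsLevyMeasure μ) (hβ : 0 < β)
    (hA : ∀ ξ, psiU μ ξ ≤ β * psiL μ ξ) :
    ∃ D : ℕ → ℝ, ∀ ρ t, 0 ≤ t → t * cosExp μ ρ = 1 →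
      IsSmallJump (smallJumps μ ρ t) (3 * β) D := by
  obtain ⟨D, hD⟩ := exists_decay_of_rpow_sub_le (C := 6 * β) (growthExponent_pos hβ)
    (by positivity : 0 < 1 / (6 * β))
  refine ⟨D, fun ρ t ht hρ => ?_⟩
  have hsupp : ∀ᵐ u ∂(ENNReal.ofReal t • μ.restrict {u : ℝ | |ρ * u| ≤ 1}), |ρ * u| ≤ 1 :=
    Measure.ae_smul_measure (ae_restrict_mem (measurableSet_abs_mul_le_one ρ)) _
  have hmin : ∀ u : ℝ, |ρ * u| ≤ 1 → min ((ρ * u) ^ 2) 1 = (ρ * u) ^ 2 := fun u hu =>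
    min_eq_left ((sq_le_one_iff_abs_le_one _).2 hu)
  have hmeas : Measurable (ρ * · : ℝ → ℝ) := measurable_const_mul ρ
  refine ⟨?_, ?_, ?_, fun k η => hD _ (fun η hη => hμ.rpow_sub_le_cosExp_smallJumps hβ hA ht hρ hη)
    k η⟩
  · rwa [smallJumps, ae_map_iff hmeas.aemeasurable (measurableSet_le (by fun_prop)
      measurable_const)]
  · rw [smallJumps, integrable_map_measure (by fun_prop) hmeas.aemeasurable]
    exact ((hμ.integrable_min_sq_one ρ).restrict.smul_measure ENNReal.ofReal_ne_top).congr
      (hsupp.mono hmin)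
  · rw [smallJumps, integral_map hmeas.aemeasurable (by fun_prop),
      ← integral_congr_ae (hsupp.mono hmin), integral_smul_measure, ENNReal.toReal_ofReal ht,
      smul_eq_mul]
    refine le_trans ?_ (hμ.mul_psiU_le hβ.le hA ht hρ)
    gcongr
    exact setIntegral_le_integral (hμ.integrable_min_sq_one ρ) (ae_of_all _ fun u => by positivity)

end Decomposition

/-! ### The transition density -/

section TransitionDensity

variable {μ : Measure ℝ} {ρ t K : ℝ} {D : ℕ → ℝ}

/-- The transition density at time `t`: the smooth density of the small jump part, convolved with
the compound Poisson law `exp(-Λ(ℝ)) ∑ Λ^{*m} / m!` of the large jumps. -/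
noncomputable def transitionDensity (μ : Measure ℝ) (ρ t x : ℝ) : ℝ :=
  Real.exp (-(bigJumps μ ρ t).real Set.univ) *
    (ρ * scaledConv (jumpDensity (smallJumps μ ρ t)) ρ (convExp (bigJumps μ ρ t)) x)

theorem abs_scaledConv_le {G h : ℝ → ℝ} {E : Measure ℝ} [IsFiniteMeasure E] {M : ℝ}
    (hh : Measurable h) (hM : ∀ x, |h x| ≤ M) (hGh : ∀ x, |G x| ≤ h x) (ρ x : ℝ) :
    |scaledConv G ρ E x| ≤ scaledConv h ρ E x :=
  norm_integral_le_of_norm_le (f := fun y => G ((x - y) * ρ)) (integrable_comp_sub_mul hh hM ρ x)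
    (ae_of_all _ fun _ => hGh _)

theorem transitionDensity_nonneg [μ.IsNegInvariant] (hρ : 0 ≤ ρ)
    (hs : IsSmallJump (smallJumps μ ρ t) K D) (x : ℝ) : 0 ≤ transitionDensity μ ρ t x :=
  mul_nonneg (Real.exp_nonneg _) (mul_nonneg hρ (integral_nonneg fun _ => hs.jumpDensity_nonneg _))

section Finite

variable [IsFiniteMeasure (bigJumps μ ρ t)]

theorem contDiff_transitionDensity (hs : IsSmallJump (smallJumps μ ρ t) K D) :
    ContDiff ℝ (⊤ : ℕ∞) (transitionDensity μ ρ t) :=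
  contDiff_const.mul (contDiff_const.mul (contDiff_scaledConv hs.contDiff_jumpDensity
    hs.abs_iteratedDeriv_jumpDensity_le_jumpConst ρ))

theorem integrable_transitionDensity (hρ : ρ ≠ 0) (hs : IsSmallJump (smallJumps μ ρ t) K D) :
    Integrable (transitionDensity μ ρ t) :=
  ((integrable_scaledConv hs.integrable_jumpDensity hρ).const_mul _).const_mul _

theorem iteratedDeriv_transitionDensity (hs : IsSmallJump (smallJumps μ ρ t) K D) (k : ℕ)
    (x : ℝ) :
    iteratedDeriv k (transitionDensity μ ρ t) x =
      Real.exp (-(bigJumps μ ρ t).real Set.univ) * (ρ ^ (k + 1) *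
        scaledConv (iteratedDeriv k (jumpDensity (smallJumps μ ρ t))) ρ
          (convExp (bigJumps μ ρ t)) x) := by
  unfold transitionDensity
  rw [iteratedDeriv_const_mul_field, iteratedDeriv_const_mul_field,
    iteratedDeriv_scaledConv hs.contDiff_jumpDensity hs.abs_iteratedDeriv_jumpDensity_le_jumpConst]
  ring

theorem abs_iteratedDeriv_transitionDensity_le (hρ : 0 ≤ ρ)
    (hs : IsSmallJump (smallJumps μ ρ t) K D) (k : ℕ) (x : ℝ) :
    |iteratedDeriv k (transitionDensity μ ρ t) x| ≤
      ρ ^ (k + 1) * scaledConv (fUpperSym (jumpConst K D k) (1 / 8)) ρ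
        (convExp (bigJumps μ ρ t)) x := by
  have hconst : Real.exp (-(bigJumps μ ρ t).real Set.univ) ≤ 1 :=
    Real.exp_le_one_iff.2 (neg_nonpos.2 measureReal_nonneg)
  rw [iteratedDeriv_transitionDensity hs, abs_mul, abs_mul, Real.abs_exp,
    abs_of_nonneg (by positivity : 0 ≤ ρ ^ (k + 1))]
  refine (mul_le_of_le_one_left (by positivity) hconst).trans ?_
  gcongr
  exact abs_scaledConv_le (continuous_fUpperSym _ _).measurable
    (abs_fUpperSym_le (hs.jumpConst_pos k).le (by norm_num))
    (hs.abs_iteratedDeriv_jumpDensity_le k) ρ x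

theorem scaledConv_fLower_le_transitionDensity [μ.IsNegInvariant] (hρ : 0 ≤ ρ) {L : ℝ}
    (hs : IsSmallJump (smallJumps μ ρ t) K D) (hL : (bigJumps μ ρ t).real Set.univ ≤ L) (x : ℝ) :
    ρ * scaledConv (fLower (Real.exp (-L) * (gaussianPeak (K + 1) / 2))
        (gaussianPeak (K + 1) / (2 * jumpConst K D 1))) ρ (convExp (bigJumps μ ρ t)) x ≤
      transitionDensity μ ρ t x := by
  have hpeak := (gaussianPeak_pos (by linarith [hs.nonneg] : 0 < K + 1)).le
  rw [transitionDensity, mul_left_comm]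
  refine mul_le_mul_of_nonneg_left ?_ hρ
  rw [scaledConv, scaledConv, ← integral_const_mul]
  refine integral_mono
    (integrable_comp_sub_mul (measurable_fLower _ _) (abs_fLower_le (by positivity) _) ρ x)
    ((integrable_comp_sub_mul hs.contDiff_jumpDensity.continuous.measurable
      (hs.abs_iteratedDeriv_jumpDensity_le_jumpConst 0) ρ x).const_mul _) fun y => ?_
  simp only [fLower, mul_assoc (Real.exp (-L))]
  exact mul_le_mul (Real.exp_le_exp.2 (neg_le_neg hL)) (hs.fLower_le_jumpDensity _)
    (by positivity) (Real.exp_nonneg _)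

end Finite

theorem charFun_transitionDensity [μ.IsNegInvariant] (hμ : IsLevyMeasure μ) (ht : 0 ≤ t)
    (hρ : 0 < ρ) (hs : IsSmallJump (smallJumps μ ρ t) K D) (ξ : ℝ) :
    charFun (volume.withDensity fun x => ENNReal.ofReal (transitionDensity μ ρ t x)) ξ =
      Complex.exp (-(t * cosExp μ ξ : ℝ)) := by
  have := hμ.isFiniteMeasure_bigJumps ρ t
  have hsum := hμ.cosExp_smallJumps_add_cosExp_bigJumps (ρ := ρ) ht (ξ / ρ)
  rw [mul_div_cancel₀ ξ hρ.ne'] at hsum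
  rw [charFun_withDensity_ofReal (contDiff_transitionDensity hs).continuous.measurable
    (transitionDensity_nonneg hρ.le hs)]
  simp only [transitionDensity, Complex.ofReal_mul (Real.exp _), mul_left_comm (Complex.exp _)]
  rw [integral_const_mul, integral_cexp_mul_scaledConv hs.integrable_jumpDensity hρ,
    hs.integral_cexp_mul_jumpDensity, charFun_convExp, charFun_of_isNegInvariant, ← hsum,
    Complex.ofReal_exp, ← Complex.exp_add, ← Complex.exp_add]
  push_cast
  ring_nf

section KernelEstimates

variable {ρ : ℝ → ℝ}

theorem isSmoothTransitionDensity_transitionDensity [μ.IsNegInvariant] (hμ : IsLevyMeasure μ)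
    (hρ : ∀ t, 0 < t → 0 < ρ t) (hs : ∀ t, 0 < t → IsSmallJump (smallJumps μ (ρ t) t) K D)
    {Ω : Type*} [MeasurableSpace Ω] {P : Measure Ω} [IsFiniteMeasure P] {Z : ℝ≥0 → Ω → ℝ}
    (hZ : HasCharExponent Z P fun ξ => cosExp μ ξ) :
    IsSmoothTransitionDensity Z P fun t => transitionDensity μ (ρ t) t := by
  intro t ht
  have := hμ.isFiniteMeasure_bigJumps (ρ t) t
  have := isFiniteMeasure_withDensity_ofReal
    (integrable_transitionDensity (hρ t ht).ne' (hs t ht)).2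
  refine ⟨contDiff_transitionDensity (hs t ht), transitionDensity_nonneg (hρ t ht).le (hs t ht),
    Measure.ext_of_charFun (funext fun ξ => ?_)⟩
  rw [hZ t ξ, charFun_transitionDensity hμ t.coe_nonneg (hρ t ht) (hs t ht) ξ]
  push_cast
  rw [neg_mul]

theorem upperCompoundKernelEstimate_abs_iteratedDeriv_transitionDensity (hμ : IsLevyMeasure μ)
    (hρ : ∀ t, 0 < t → 0 ≤ ρ t) (hs : ∀ t, 0 < t → IsSmallJump (smallJumps μ (ρ t) t) K D)
    (k : ℕ) :
    UpperCompoundKernelEstimate (fun t x => |iteratedDeriv k (transitionDensity μ (ρ t) t) x|)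
      (Set.Ioi 0 ×ˢ Set.univ) (fun t => ρ t ^ (k + 1)) (fUpperSym (jumpConst K D k) (1 / 8)) ρ
      (fun t => bigJumps μ (ρ t) t) := by
  rintro t x ⟨ht : 0 < t, -⟩
  have := hμ.isFiniteMeasure_bigJumps (ρ t) t
  have hmeas := (continuous_fUpperSym (jumpConst K D k) (1 / 8)).measurable
  have hbound := abs_fUpperSym_le ((hs t ht).jumpConst_pos k).le (by norm_num : (0 : ℝ) ≤ 1 / 8)
  refine ⟨compoundKernelConverges hmeas hbound x, ?_⟩
  rw [(hasSum_compoundTerm hmeas hbound x).tsum_eq]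
  exact abs_iteratedDeriv_transitionDensity_le (hρ t ht) (hs t ht) k x

theorem upperCompoundKernelEstimate_transitionDensity (hμ : IsLevyMeasure μ)
    (hρ : ∀ t, 0 < t → 0 ≤ ρ t) (hs : ∀ t, 0 < t → IsSmallJump (smallJumps μ (ρ t) t) K D) :
    UpperCompoundKernelEstimate (fun t => transitionDensity μ (ρ t) t) (Set.Ioi 0 ×ˢ Set.univ) ρ
      (fUpperSym (jumpConst K D 0) (1 / 8)) ρ (fun t => bigJumps μ (ρ t) t) := by
  intro t x htx
  have h := upperCompoundKernelEstimate_abs_iteratedDeriv_transitionDensity hμ hρ hs 0 t x htx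
  simp only [zero_add, pow_one, iteratedDeriv_zero] at h
  exact ⟨h.1, (le_abs_self _).trans h.2⟩

theorem lowerCompoundKernelEstimate_transitionDensity [μ.IsNegInvariant] (hμ : IsLevyMeasure μ)
    (hρ : ∀ t, 0 < t → 0 ≤ ρ t) (hs : ∀ t, 0 < t → IsSmallJump (smallJumps μ (ρ t) t) K D)
    {L : ℝ} (hL : ∀ t, 0 < t → (bigJumps μ (ρ t) t).real Set.univ ≤ L) :
    LowerCompoundKernelEstimate (fun t => transitionDensity μ (ρ t) t) (Set.Ioi 0 ×ˢ Set.univ) ρ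
      (fLower (Real.exp (-L) * (gaussianPeak (K + 1) / 2))
        (gaussianPeak (K + 1) / (2 * jumpConst K D 1))) ρ
      (fun t => bigJumps μ (ρ t) t) := by
  rintro t x ⟨ht : 0 < t, -⟩
  have := hμ.isFiniteMeasure_bigJumps (ρ t) t
  have hpeak := (gaussianPeak_pos (by linarith [(hs t ht).nonneg] : 0 < K + 1)).le
  have hmeas := measurable_fLower (Real.exp (-L) * (gaussianPeak (K + 1) / 2))
    (gaussianPeak (K + 1) / (2 * jumpConst K D 1))
  have hbound := abs_fLower_le (b₃ := Real.exp (-L) * (gaussianPeak (K + 1) / 2)) (by positivity)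
    (gaussianPeak (K + 1) / (2 * jumpConst K D 1))
  refine ⟨compoundKernelConverges hmeas hbound x, ?_⟩
  rw [(hasSum_compoundTerm hmeas hbound x).tsum_eq]
  exact scaledConv_fLower_le_transitionDensity (hρ t ht) (hs t ht) (hL t ht) x

end KernelEstimates

end TransitionDensity

section Mono

variable {g : ℝ → ℝ → ℝ} {A B : Set (ℝ × ℝ)} {σ h ζ : ℝ → ℝ} {Q : ℝ → Measure ℝ}

theorem UpperCompoundKernelEstimate.mono (hg : UpperCompoundKernelEstimate g B σ h ζ Q)
    (hAB : A ⊆ B) : UpperCompoundKernelEstimate g A σ h ζ Q :=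
  fun t x hA => hg t x (hAB hA)

theorem LowerCompoundKernelEstimate.mono (hg : LowerCompoundKernelEstimate g B σ h ζ Q)
    (hAB : A ⊆ B) : LowerCompoundKernelEstimate g A σ h ζ Q :=
  fun t x hA => hg t x (hAB hA)

end Mono

end LevyKernel

open LevyKernel in
theorem theorem4_general {Ω : Type*} [MeasurableSpace Ω] (P : Measure Ω) [IsFiniteMeasure P]
    (Z : ℝ≥0 → Ω → ℝ) (a : ℝ) (μ : Measure ℝ) (hμ : IsLevyMeasure μ) (hμ0 : μ ≠ 0)
    (ψ : ℝ → ℂ) (hψ : ψ = charExponent a μ)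
    (hZψ : HasCharExponent Z P ψ) (hsymm : IsSymmetricProcess Z P) (hA : ConditionA μ) :
    ∃ p : ℝ → ℝ → ℝ, IsSmoothTransitionDensity Z P p ∧
      (∃ b₁ b₂ b₃ b₄ : ℝ, 0 < b₁ ∧ 0 < b₂ ∧ 0 < b₃ ∧ 0 < b₄ ∧
        UpperCompoundKernelEstimate p (Set.Ioi 0 ×ˢ Set.univ)
          (rho ψ) (fUpperSym b₁ b₂) (rho ψ) (Lam ψ μ) ∧
        LowerCompoundKernelEstimate p (Set.Ioi 0 ×ˢ Set.univ)
          (rho ψ) (fLower b₃ b₄) (rho ψ) (Lam ψ μ)) ∧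
      (∀ k : ℕ, ∃ b₁ b₂ : ℝ, 0 < b₁ ∧ 0 < b₂ ∧
        UpperCompoundKernelEstimate (fun t x => |iteratedDeriv k (p t) x|)
          (Set.Ioi 0 ×ˢ Set.univ) (fun t => rho ψ t ^ (k + 1)) (fUpperSym b₁ b₂) (rho ψ)
          (Lam ψ μ)) := by
  obtain ⟨β, hβ1, hβ⟩ := hA
  have hβ0 : 0 < β := zero_lt_one.trans hβ1
  subst hψ
  have him := hZψ.im_eq_zero hsymm
  have : μ.IsNegInvariant := hμ.isNegInvariant him
  have hρ (t : ℝ) (ht : 0 < t) := hμ.rho_pos hμ0 hβ0 hβ a ht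
  have hρ0 (t : ℝ) (ht : 0 < t) := (hρ t ht).le
  have hscale (t : ℝ) (ht : 0 < t) := hμ.mul_cosExp_rho hμ0 hβ0 hβ a ht
  obtain ⟨D, hD⟩ := hμ.exists_isSmallJump_smallJumps hβ0 hβ
  have hs (t : ℝ) (ht : 0 < t) := hD _ t ht.le (hscale t ht)
  have hL (t : ℝ) (ht : 0 < t) := (hμ.bigJumps_real_univ_le ht.le).trans
    (hμ.mul_psiU_le hβ0.le hβ ht.le (hscale t ht))
  have hconst (k : ℕ) : 0 < jumpConst (3 * β) D k := (hs 1 one_pos).jumpConst_pos k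
  have hpeak : 0 < gaussianPeak (3 * β + 1) := gaussianPeak_pos (by positivity)
  exact ⟨_, isSmoothTransitionDensity_transitionDensity hμ hρ hs
      (hμ.charExponent_eq_cosExp him ▸ hZψ),
    ⟨_, 1 / 8, _, _, hconst 0, by norm_num, by positivity,
      div_pos hpeak (mul_pos two_pos (hconst 1)),
      upperCompoundKernelEstimate_transitionDensity hμ hρ0 hs,
      lowerCompoundKernelEstimate_transitionDensity hμ hρ0 hs hL⟩,
    fun k => ⟨_, 1 / 8, hconst k, by norm_num,
      upperCompoundKernelEstimate_abs_iteratedDeriv_transitionDensity hμ hρ0 hs k⟩⟩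

theorem theorem4 {Ω : Type*} [MeasurableSpace Ω] (P : Measure Ω) [IsProbabilityMeasure P]
    (Z : ℝ≥0 → Ω → ℝ) (hZ : LevyKernel.IsLevyProcess Z P)
    (a : ℝ) (μ : Measure ℝ) (hμ : LevyKernel.IsLevyMeasure μ) (hμ_inf : μ Set.univ = ∞)
    (ψ : ℝ → ℂ) (hψ : ψ = LevyKernel.charExponent a μ)
    (hZψ : LevyKernel.HasCharExponent Z P ψ)
    (hsymm : LevyKernel.IsSymmetricProcess Z P)
    (hA : LevyKernel.ConditionA μ) :
    ∃ p : ℝ → ℝ → ℝ, LevyKernel.IsSmoothTransitionDensity Z P p ∧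
      (∀ t₀ : ℝ, 0 < t₀ → ∃ b₁ b₂ b₃ b₄ : ℝ, 0 < b₁ ∧ 0 < b₂ ∧ 0 < b₃ ∧ 0 < b₄ ∧
        LevyKernel.UpperCompoundKernelEstimate (fun t x => p t x)
          (Set.Ioc 0 t₀ ×ˢ Set.univ)
          (LevyKernel.rho ψ) (LevyKernel.fUpperSym b₁ b₂) (LevyKernel.rho ψ)
          (LevyKernel.Lam ψ μ) ∧
        LevyKernel.LowerCompoundKernelEstimate (fun t x => p t x)
          (Set.Ioc 0 t₀ ×ˢ Set.univ)
          (LevyKernel.rho ψ) (LevyKernel.fLower b₃ b₄) (LevyKernel.rho ψ)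
          (LevyKernel.Lam ψ μ)) ∧
      (∀ k : ℕ, 1 ≤ k → ∀ t₀ : ℝ, 0 < t₀ → ∃ b₁ b₂ : ℝ, 0 < b₁ ∧ 0 < b₂ ∧
        LevyKernel.UpperCompoundKernelEstimate (fun t x => |iteratedDeriv k (p t) x|)
          (Set.Ioc 0 t₀ ×ˢ Set.univ)
          (fun t => LevyKernel.rho ψ t ^ (k + 1)) (LevyKernel.fUpperSym b₁ b₂)
          (LevyKernel.rho ψ) (LevyKernel.Lam ψ μ)) := by
  obtain ⟨p, hp, ⟨b₁, b₂, b₃, b₄, h₁, h₂, h₃, h₄, hupper, hlower⟩, hderiv⟩ :=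
    theorem4_general P Z a μ hμ (by rintro rfl; simp at hμ_inf) ψ hψ hZψ hsymm hA
  have hsub (t₀ : ℝ) : Set.Ioc 0 t₀ ×ˢ (Set.univ : Set ℝ) ⊆ Set.Ioi 0 ×ˢ Set.univ :=
    Set.prod_mono_left Set.Ioc_subset_Ioi_self
  refine ⟨p, hp, fun t₀ _ => ⟨b₁, b₂, b₃, b₄, h₁, h₂, h₃, h₄, hupper.mono (hsub t₀),
    hlower.mono (hsub t₀)⟩, fun k _ t₀ _ => ?_⟩
  obtain ⟨c₁, c₂, hc₁, hc₂, hk⟩ := hderiv k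
  exact ⟨c₁, c₂, hc₁, hc₂, hk.mono (hsub t₀)⟩
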